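/- Let $K$ be a field, considered with the trivial $\mathbb Z$-grading, and for a positive integer $m$ let $K[x^m,x^{-m}]$ be graded by $K[x^m,x^{-m}]_{mt}=Kx^{mt}$ for $t\in\mathbb Z$ and $K[x^m,x^{-m}]_d=0$ if $m\nmid d$. For a $\mathbb Z$-graded algebra $A$ and integers $\gamma_1,\dots,\gamma_n$, let $\mathbb M_n(A)(\gamma_1,\dots,\gamma_n)$ be the matrix algebra $\mathbb M_n(A)$ graded so that $(a_{ij})$ is in the $d$-component iff $a_{ij}\in A_{-\gamma_i+d+\gamma_j}$ for all $i,j$. In a list of shifts, $l(t)$ means that $t$ is repeated $l$ times. A directed graph $E$ has a set of vertices $E^0$, a set of edges $E^1$, and source and range maps $\mathbf s,\mathbf r:E^1\to E^0$. It is finite if $E^0$ and $E^1$ are finite. A cycle is a nontrivial closed path whose edges have pairwise different sources, and $E$ is no-exit if every vertex of every cycle emits just one edge. The Leavitt path algebra $L_K(E)$ is the (not necessarily unital) $K$-algebra generated by $E^0\cup E^1\cup\{e^*\mid e\in E^1\}$ subject to the relations, for all vertices $v,w$ and edges $e,f$: $vv=v$, and $vw=0$ if $v\ne w$; $\mathbf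 s(e)e=e\mathbf r(e)=e$; $\mathbf r(e)e^*=e^*\mathbf s(e)=e^*$; $e^*e=\mathbf r(e)$, and $e^*f=0$ if $e\neq f$; and $v=\sum_{e\in \mathbf s^{-1}(v)}ee^*$ whenever $\mathbf s^{-1}(v)$ is finite and nonempty. It is $\mathbb Z$-graded so that the $d$-component is the $K$-linear span of the elements $pq^*$ for paths $p,q$ with $|p|-|q|=d$. Graded isomorphisms are isomorphisms of rings which preserve the homogeneous components, and $\cong_{\rm gr}$ denotes the existence of one. *Representatives.* Let $n\ge 1$. - Nonnegative integers $k$ and $l_0,\dots,l_k$ are representatives of the graded isomorphism class of $\mathbb M_n(K)(\gamma_1,\dots,\gamma_n)$ if there are integers $\gamma'_1,\dots,\gamma'_n$ with $\mathbb M_n(K)(\gamma_1,\dots,\gamma_n)\cong_{\rm gr}\mathbb M_n(K)(\gamma_1',\dots,\gamma_n')$ such that, when the smallest $\gamma'_j$ is subtracted from all of them, the largest element of the new list is $k$ and each $t\in\{0,\dots,k\}$ appears $l_t$ times in it. - Nonnegative integers $l_0,\dots,l_{m-1}$ are representatives of the graded isomorphism class of $\mathbb M_n(K[x^m,x^{-m}])(\delta_1,\dots,\delta_n)$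 if there are integers $\delta'_1,\dots,\delta'_n$ with $\mathbb M_n(K[x^m,x^{-m}])(\delta_1,\dots,\delta_n)\cong_{\rm gr}\mathbb M_n(K[x^m,x^{-m}])(\delta'_1,\dots,\delta'_n)$ such that $l_t$ is the number of indices $j$ with $\delta'_j\equiv t \pmod m$, for each $t\in\{0,\dots,m-1\}$. **Proposition.** Let $k,n$ be nonnegative integers, let $k_i,n_j,m_j$ be positive integers, and let $\gamma_{i1},\dots,\gamma_{ik_i},\delta_{j1},\dots,\delta_{jn_j}$ be arbitrary integers for $i=1,\dots,k$, $j=1,\dots,n$. If $$R=\bigoplus_{i=1}^k \mathbb M_{k_i}(K)(\gamma_{i1},\dots,\gamma_{ik_i})\oplus\bigoplus_{j=1}^n\mathbb M_{n_j}(K[x^{m_j},x^{-m_j}])(\delta_{j1},\dots,\delta_{jn_j}),$$ then the following conditions are equivalent. 1. $R\cong_{\rm gr}L_K(E)$ for some directed graph $E$. 2. $R\cong_{\rm gr}L_K(E)$ for some finite no-exit graph $E$. 3. There are nonnegative integers $k'_i$ and positive integers $l_{i1},\dots,l_{ik'_i}$, for $i=1,\dots,k$, and positive integers $s_{j0},\dots,s_{j(m_j-1)}$,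 for $j=1,\dots,n$, such that $k_i=1+l_{i1}+\dots+l_{ik'_i}$ for all $i$, $n_j=s_{j0}+\dots+s_{j(m_j-1)}$ for all $j$, and $$R\cong_{\rm gr}\bigoplus_{i=1}^k \mathbb M_{k_i}(K)(0,l_{i1}(1),\dots,l_{ik'_i}(k'_i))\oplus\bigoplus_{j=1}^n\mathbb M_{n_j}(K[x^{m_j},x^{-m_j}])(s_{j0}(0),\dots,s_{j(m_j-1)}(m_j-1)).$$ 4. If $k'_i$ and $l_{i0},\dots,l_{ik'_i}$ are representatives of the graded isomorphism class of $\mathbb M_{k_i}(K)(\gamma_{i1},\dots,\gamma_{ik_i})$ for $i=1,\dots,k$, and $s_{j0},\dots,s_{j(m_j-1)}$ are representatives of the graded isomorphism class of $\mathbb M_{n_j}(K[x^{m_j},x^{-m_j}])(\delta_{j1},\dots,\delta_{jn_j})$ for $j=1,\dots,n$, then $l_{i0}=1$ and $l_{i1},\dots,l_{ik'_i}$ are positive for all $i$, and $s_{j0},\dots,s_{j(m_j-1)}$ are positive for all $j$. -/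

import Mathlib

universe u v w

namespace LPA

open Quiver
open scoped LaurentPolynomial

/-! ### Directed graphs

A directed graph `E` is a quiver on its set of vertices `V`; its set of edges is `Quiver.Total V`,
where an edge `e` has source `e.left` and range `e.right`. -/

section Graphs

variable {V : Type u} [Quiver.{v} V]

/-- The list of edges of a path, in order. -/
def edges {a : V} : ∀ {b : V}, Path a b → List (Total V)
  | _, Path.nil => []
  | _, Path.cons p e => edges p ++ [⟨_, _, e⟩]

/-- The closed path `c` is a cycle: it is nontrivial and its edges have pairwise different
sources. -/
def IsCycle {a : V} (c : Path a a) : Prop :=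
  c.length ≠ 0 ∧ ((edges c).map Total.left).Nodup

variable (V)

/-- Every vertex of every cycle emits just one edge. -/
def NoExit : Prop :=
  ∀ (a : V) (c : Path a a), IsCycle c →
    ∀ x ∈ (edges c).map Total.left, ∃! e : Total V, e.left = x

/-- The graph has finitely many vertices and finitely many edges. -/
def FiniteGraph : Prop :=
  Finite V ∧ Finite (Total V)

end Graphs

/-! ### Leavitt path algebras -/

section Leavitt

variable (K : Type w) [Field K] (V : Type u) [Quiver.{v} V]

/-- The generators of the Leavitt path algebra: vertices `x`, edges `e`, ghost edges `e*`. -/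
inductive Gen : Type (max u v)
  | vertex (x : V) : Gen
  | edge (e : Total V) : Gen
  | ghost (e : Total V) : Gen

variable {V} in
/-- A vertex, as an element of the free algebra. -/
def fv (x : V) : FreeAlgebra K (Gen V) := FreeAlgebra.ι K (Gen.vertex x)

variable {V} in
/-- An edge, as an element of the free algebra. -/
def fe (e : Total V) : FreeAlgebra K (Gen V) := FreeAlgebra.ι K (Gen.edge e)

variable {V} in
/-- A ghost edge, as an element of the free algebra. -/
def fg (e : Total V) : FreeAlgebra K (Gen V) := FreeAlgebra.ι K (Gen.ghost e)

/-- The defining relations of the Leavitt path algebra. In `ck2`, the hypotheses say that the set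
`s⁻¹(x)` of the edges with source `x` is finite (equal to the finite set `S`) and nonempty, i.e.
that `x` is a regular vertex. -/
inductive Rel : FreeAlgebra K (Gen V) → FreeAlgebra K (Gen V) → Prop
  | v_ne (x y : V) (h : x ≠ y) : Rel (fv K x * fv K y) 0
  | v_self (x : V) : Rel (fv K x * fv K x) (fv K x)
  | e1_source (e : Total V) : Rel (fv K e.left * fe K e) (fe K e)
  | e1_range (e : Total V) : Rel (fe K e * fv K e.right) (fe K e)
  | e2_range (e : Total V) : Rel (fv K e.right * fg K e) (fg K e)
  | e2_source (e : Total V) : Rel (fg K e * fv K e.left) (fg K e)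
  | ck1_ne (e f : Total V) (h : e ≠ f) : Rel (fg K e * fe K f) 0
  | ck1_self (e : Total V) : Rel (fg K e * fe K e) (fv K e.right)
  | ck2 (x : V) (S : Finset (Total V)) (hS : ∀ e, e ∈ S ↔ e.left = x) (hne : S.Nonempty) :
      Rel (fv K x) (∑ e ∈ S, fe K e * fg K e)

/-- The unital `K`-algebra with the given generators and relations. It is an auxiliary object:
when `V` is infinite it is the Leavitt path algebra with an identity adjoined. -/
abbrev UnitalHull : Type (max u v w) := RingQuot (Rel K V)

variable {V} in
/-- The class of a generator. -/
noncomputable def gen (g : Gen V) : UnitalHull K V :=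
  RingQuot.mkAlgHom K (Rel K V) (FreeAlgebra.ι K g)

/-- The Leavitt path algebra `L_K(E)`, as an algebra which need not have an identity: it is the
quotient of the free non-unital `K`-algebra on the vertices, the edges and the ghost edges by the
two-sided ideal `I` of the defining relations. The free non-unital algebra is the ideal `F` of
the free unital algebra consisting of the elements without constant term, and `I` is contained in
`F`; so `F / I` is the non-unital subalgebra generated by the generators in the quotient of the
free unital algebra by `I`. -/
noncomputable def carrier : NonUnitalSubalgebra K (UnitalHull K V) :=
  NonUnitalAlgebra.adjoin K (Set.range (gen K (V := V)))

/-- The Leavitt path algebra of the graph `V` over `K`. -/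
abbrev LeavittPathAlgebra : Type (max u v w) := carrier K V

variable {V}

/-- A generator, as an element of the Leavitt path algebra. -/
noncomputable def lgen (g : Gen V) : LeavittPathAlgebra K V :=
  ⟨gen K g, NonUnitalAlgebra.subset_adjoin K ⟨g, rfl⟩⟩

/-- The element `p` of the Leavitt path algebra given by a path `p`; a trivial path gives its
vertex. -/
noncomputable def pathElem {a : V} : ∀ {b : V}, Path a b → LeavittPathAlgebra K V
  | _, Path.nil => lgen K (Gen.vertex a)
  | _, Path.cons p e => pathElem p * lgen K (Gen.edge ⟨_, _, e⟩)

/-- The element `q*` of the Leavitt path algebra given by a path `q`. -/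
noncomputable def ghostElem {a : V} : ∀ {b : V}, Path a b → LeavittPathAlgebra K V
  | _, Path.nil => lgen K (Gen.vertex a)
  | _, Path.cons q e => lgen K (Gen.ghost ⟨_, _, e⟩) * ghostElem q

variable (V)

/-- The natural `ℤ`-grading: the component of degree `d` is the span of the elements `p q*` with
`|p| - |q| = d`. Only the paths `p`, `q` with the same range matter, since `p q* = 0` otherwise. -/
noncomputable def lpaGrading (d : ℤ) : Submodule K (LeavittPathAlgebra K V) :=
  Submodule.span K {z | ∃ (a b c : V) (p : Path a c) (q : Path b c),
    (p.length : ℤ) - q.length = d ∧ z = pathElem K p * ghostElem K q}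

end Leavitt

/-! ### Graded isomorphisms and graded matrix algebras -/

section Graded

variable {K : Type w} [Field K]

/-- There is a graded ring isomorphism between the two algebras with the given families of
homogeneous components. -/
def GradedIso {A : Type u} {B : Type v} [NonUnitalRing A] [NonUnitalRing B] [Module K A]
    [Module K B] (𝒜 : ℤ → Submodule K A) (ℬ : ℤ → Submodule K B) : Prop :=
  ∃ f : A ≃+* B, ∀ (d : ℤ) (x : A), x ∈ 𝒜 d ↔ f x ∈ ℬ d

variable (K) in
/-- The trivial grading of `K`. -/
def trivialGrading (d : ℤ) : Submodule K K := if d = 0 then ⊤ else ⊥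

variable (K) in
/-- The grading of `K[x^m, x^{-m}]`, the ring of Laurent polynomials in the variable `T = x^m`, in
which `T ^ i = x ^ (m * i)` has degree `m * i`. -/
noncomputable def laurentGrading (m : ℕ) (d : ℤ) : Submodule K K[T;T⁻¹] :=
  AddMonoidAlgebra.gradeBy K (fun i : ℤ => (m : ℤ) * i) d

/-- The grading of the matrix algebra `M_n(A)(γ_1, …, γ_n)`: a matrix has degree `d` if its
`(i, j)` entry has degree `-γ_i + d + γ_j` for all `i`, `j`. -/
def matrixGrading {A : Type u} [Ring A] [Module K A] (𝒜 : ℤ → Submodule K A)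
    {ι : Type} (γ : ι → ℤ) (d : ℤ) : Submodule K (Matrix ι ι A) where
  carrier := {M | ∀ i j, M i j ∈ 𝒜 (-γ i + d + γ j)}
  add_mem' hx hy i j := add_mem (hx i j) (hy i j)
  zero_mem' _ _ := zero_mem _
  smul_mem' c _ hx i j := Submodule.smul_mem _ c (hx i j)

variable (K) in
/-- The algebra `⨁ i, M_{I i}(K) ⊕ ⨁ j, M_{J j}(K[T, T⁻¹])` (finite direct sums). -/
abbrev MatrixSum {k n : ℕ} (I : Fin k → Type) (J : Fin n → Type) : Type w :=
  (∀ i, Matrix (I i) (I i) K) × (∀ j, Matrix (J j) (J j) K[T;T⁻¹])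

variable (K) in
/-- The grading of `⨁ i, M(K)(γ i) ⊕ ⨁ j, M(K[x^{m j}, x^{-m j}])(δ j)`. -/
def matrixSumGrading {k n : ℕ} {I : Fin k → Type} {J : Fin n → Type}
    (γ : ∀ i, I i → ℤ) (m : Fin n → ℕ) (δ : ∀ j, J j → ℤ) (d : ℤ) :
    Submodule K (MatrixSum K I J) where
  carrier := {x | (∀ i, x.1 i ∈ matrixGrading (trivialGrading K) (γ i) d) ∧
    (∀ j, x.2 j ∈ matrixGrading (laurentGrading K (m j)) (δ j) d)}
  add_mem' hx hy := ⟨fun i => add_mem (hx.1 i) (hy.1 i), fun j => add_mem (hx.2 j) (hy.2 j)⟩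
  zero_mem' := ⟨fun _ => zero_mem _, fun _ => zero_mem _⟩
  smul_mem' c _ hx :=
    ⟨fun i => Submodule.smul_mem _ c (hx.1 i), fun j => Submodule.smul_mem _ c (hx.2 j)⟩

/-- The index set of the list `l_0(0), l_1(1), …, l_{r-1}(r-1)`, in which `t` appears `l_t`
times. -/
abbrev Blocks {r : ℕ} (l : Fin r → ℕ) : Type := Σ t : Fin r, Fin (l t)

/-- The list `l_0(0), l_1(1), …, l_{r-1}(r-1)` of shifts. -/
def blockShifts {r : ℕ} (l : Fin r → ℕ) : Blocks l → ℤ := fun x => ((x.1 : ℕ) : ℤ)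

variable (K) in
/-- `k` and `l_0, …, l_k` are representatives of the graded isomorphism class of `M_n(K)(γ)`: for
the shifts `γ'` of some algebra in this class, if the smallest element is subtracted from the list
`γ'`, then `k` is the largest element of the new list and `l_t` is the number of times that `t`
appears in it. -/
def IsRepresentatives {n : ℕ} (γ : Fin n → ℤ) (k : ℕ) (l : Fin (k + 1) → ℕ) : Prop :=
  ∃ γ' : Fin n → ℤ,
    GradedIso (matrixGrading (trivialGrading K) γ) (matrixGrading (trivialGrading K) γ') ∧
    ∃ c : ℤ, IsLeast (Set.range γ') c ∧ IsGreatest (Set.range fun j => γ' j - c) (k : ℤ) ∧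
      ∀ t, l t = (Finset.univ.filter fun j => γ' j - c = ((t : ℕ) : ℤ)).card

variable (K) in
/-- `l_0, …, l_{m-1}` are representatives of the graded isomorphism class of
`M_n(K[x^m, x^{-m}])(δ)`: for the shifts `δ'` of some algebra in this class, `l_t` is the number
of the elements of the list `δ'` whose remainder modulo `m` is `t`. -/
def IsLaurentRepresentatives (m : ℕ) {n : ℕ} (δ : Fin n → ℤ) (l : Fin m → ℕ) : Prop :=
  ∃ δ' : Fin n → ℤ,
    GradedIso (matrixGrading (laurentGrading K m) δ) (matrixGrading (laurentGrading K m) δ') ∧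
    ∀ t, l t = (Finset.univ.filter fun j => δ' j % (m : ℤ) = ((t : ℕ) : ℤ)).card

end Graded

end LPA

/-! The implications run `2 → 1 → 4 → 3 → 2`.

`1 → 4`. In a Leavitt path algebra put `f_x = x - ∑ e e*` for a vertex `x`, the sum running over
the nonzero edges `e` with source `x` (`sinkPart`). If the algebra is graded isomorphic to `R`,
only finitely many vertices and edges are nonzero, because orthogonal nonzero idempotents are
linearly independent in the finite-dimensional component `R_0`; so `1 = ∑ f_x + ∑ e e*`
(`exists_one_eq_sum`). Since `f_x e = 0 = e* f_x` for all edges `e`, every monomial `p q*` of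
positive length vanishes between two such elements: `f_x L f_y = 0` for `x ≠ y`, and `f_x L f_x`
is spanned by `f_x f_x`, hence commutative and concentrated in degree zero. On the other hand, an
index `a` of a block of `R` can be reached by some `e e*`, with `e` of degree `1`, only if there
is an index `c` in the same block whose shift is one less (modulo `m` in a block over `K[x^m,
x^{-m}]`). An index `a` without such a predecessor is therefore seen by some `f_x`. In a block
over `K` the corner `f_x R f_x` has room for only one such index (`eq_of_no_predecessor`): so the
smallest shift occurs once and there are no gaps. A block over `K[x^m, x^{-m}]` has no such index,
as `f_x R f_x` would have elements of degree `m` (`exists_predecessor_mod`). This works for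
whatever shifts define `R` up to graded isomorphism, in particular for those from which
representatives are read off. No classification of graded matrix algebras is needed, nor that
vertices are nonzero in the Leavitt path algebra.

`4 → 3`. Read off representatives from the given shifts, and sort them: subtracting a
constant from all shifts, or changing them by multiples of `m` in a block over `K[x^m, x^{-m}]`,
does not change the graded isomorphism class.

`3 → 2`. The graph has the indices of all blocks as its vertices. An index at level `t > 0` emits
one edge, to the first index at level `t - 1`; in a block over `K[x^m, x^{-m}]` levels are modulo
`m`, all indices emit an edge, and the first indices form a cycle. Every vertex emits at most one
edge, so the monomial `p q*` depends only on its degree and on the sources of `p` and `q`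
(`monomial_eq_monomial`), and the monomials correspond to the matrix units `T ^ c e_{ab}`
(`gradedIso_stepGraph`). -/

namespace LPA

open Quiver
open scoped LaurentPolynomial

/-! ### Normal forms in the Leavitt path algebra -/

section Relations

variable (K : Type w) [Field K] {V : Type u} [Quiver.{v} V]

theorem lgen_vertex_mul_ne {x y : V} (h : x ≠ y) :
    lgen K (Gen.vertex x) * lgen K (Gen.vertex y) = 0 := by
  apply Subtype.ext
  have := RingQuot.mkAlgHom_rel K (Rel.v_ne (K := K) x y h)
  simpa [fv, lgen, gen] using this

theorem lgen_vertex_mul_self (x : V) :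
    lgen K (Gen.vertex x) * lgen K (Gen.vertex x) = lgen K (Gen.vertex x) := by
  apply Subtype.ext
  have := RingQuot.mkAlgHom_rel K (Rel.v_self (K := K) x)
  simpa [fv, lgen, gen] using this

theorem lgen_left_mul_edge (e : Total V) :
    lgen K (Gen.vertex e.left) * lgen K (Gen.edge e) = lgen K (Gen.edge e) := by
  apply Subtype.ext
  have := RingQuot.mkAlgHom_rel K (Rel.e1_source (K := K) e)
  simpa [fv, fe, lgen, gen] using this

theorem lgen_edge_mul_right (e : Total V) :
    lgen K (Gen.edge e) * lgen K (Gen.vertex e.right) = lgen K (Gen.edge e) := by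
  apply Subtype.ext
  have := RingQuot.mkAlgHom_rel K (Rel.e1_range (K := K) e)
  simpa [fv, fe, lgen, gen] using this

theorem lgen_right_mul_ghost (e : Total V) :
    lgen K (Gen.vertex e.right) * lgen K (Gen.ghost e) = lgen K (Gen.ghost e) := by
  apply Subtype.ext
  have := RingQuot.mkAlgHom_rel K (Rel.e2_range (K := K) e)
  simpa [fv, fg, lgen, gen] using this

theorem lgen_ghost_mul_left (e : Total V) :
    lgen K (Gen.ghost e) * lgen K (Gen.vertex e.left) = lgen K (Gen.ghost e) := by
  apply Subtype.ext
  have := RingQuot.mkAlgHom_rel K (Rel.e2_source (K := K) e)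
  simpa [fv, fg, lgen, gen] using this

theorem lgen_ghost_mul_edge_ne {e f : Total V} (h : e ≠ f) :
    lgen K (Gen.ghost e) * lgen K (Gen.edge f) = 0 := by
  apply Subtype.ext
  have := RingQuot.mkAlgHom_rel K (Rel.ck1_ne (K := K) e f h)
  simpa [fe, fg, lgen, gen] using this

theorem lgen_ghost_mul_edge_self (e : Total V) :
    lgen K (Gen.ghost e) * lgen K (Gen.edge e) = lgen K (Gen.vertex e.right) := by
  apply Subtype.ext
  have := RingQuot.mkAlgHom_rel K (Rel.ck1_self (K := K) e)
  simpa [fv, fe, fg, lgen, gen] using this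

/-- The Cuntz-Krieger relation at a vertex which emits exactly one edge. -/
theorem lgen_edge_mul_ghost_self (e : Total V) (he : ∀ f : Total V, f.left = e.left → f = e) :
    lgen K (Gen.edge e) * lgen K (Gen.ghost e) = lgen K (Gen.vertex e.left) := by
  apply Subtype.ext
  have := RingQuot.mkAlgHom_rel K (Rel.ck2 (K := K) e.left {e}
    (fun f => by
      rw [Finset.mem_singleton]
      exact ⟨fun h => h ▸ rfl, he f⟩) ⟨e, by simp⟩)
  simpa [fv, fe, fg, lgen, gen] using this.symm

/-- To prove a statement about all elements of the Leavitt path algebra, it suffices to prove it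
for the generators and for sums, products and multiples. -/
theorem lpa_induction {p : LeavittPathAlgebra K V → Prop} (hgen : ∀ g, p (lgen K g))
    (zero : p 0) (add : ∀ x y, p x → p y → p (x + y)) (mul : ∀ x y, p x → p y → p (x * y))
    (smul : ∀ (c : K) x, p x → p (c • x)) (x : LeavittPathAlgebra K V) : p x := by
  obtain ⟨x, hx⟩ := x
  induction hx using NonUnitalAlgebra.adjoin_induction with
  | mem x hx =>
    obtain ⟨g, rfl⟩ := hx
    exact hgen g
  | add x y hx hy h1 h2 => exact add ⟨x, hx⟩ ⟨y, hy⟩ h1 h2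
  | zero => exact zero
  | mul x y hx hy h1 h2 => exact mul ⟨x, hx⟩ ⟨y, hy⟩ h1 h2
  | smul r x hx h => exact smul r ⟨x, hx⟩ h

theorem vertex_mul_pathElem {a : V} : ∀ {b : V} (p : Path a b),
    lgen K (Gen.vertex a) * pathElem K p = pathElem K p
  | _, Path.nil => lgen_vertex_mul_self K a
  | _, Path.cons p e => by rw [pathElem, ← mul_assoc, vertex_mul_pathElem p]

theorem vertex_mul_pathElem_ne {x a b : V} (p : Path a b) (h : x ≠ a) :
    lgen K (Gen.vertex x) * pathElem K p = 0 := by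
  rw [← vertex_mul_pathElem, ← mul_assoc, lgen_vertex_mul_ne K h, zero_mul]

theorem pathElem_mul_vertex {a : V} : ∀ {b : V} (p : Path a b),
    pathElem K p * lgen K (Gen.vertex b) = pathElem K p
  | _, Path.nil => lgen_vertex_mul_self K a
  | _, Path.cons p e => by
    rw [pathElem, mul_assoc]
    congr 1
    exact lgen_edge_mul_right K ⟨_, _, e⟩

theorem ghostElem_mul_vertex {a : V} : ∀ {b : V} (p : Path a b),
    ghostElem K p * lgen K (Gen.vertex a) = ghostElem K p
  | _, Path.nil => lgen_vertex_mul_self K a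
  | _, Path.cons p e => by rw [ghostElem, mul_assoc, ghostElem_mul_vertex p]

theorem vertex_mul_ghostElem {a : V} : ∀ {b : V} (p : Path a b),
    lgen K (Gen.vertex b) * ghostElem K p = ghostElem K p
  | _, Path.nil => lgen_vertex_mul_self K a
  | _, Path.cons p e => by
    rw [ghostElem, ← mul_assoc]
    congr 1
    exact lgen_right_mul_ghost K ⟨_, _, e⟩

theorem pathElem_comp {a b : V} (p : Path a b) : ∀ {c : V} (q : Path b c),
    pathElem K (p.comp q) = pathElem K p * pathElem K q
  | _, Path.nil => (pathElem_mul_vertex K p).symm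
  | _, Path.cons q e => by
    rw [Path.comp_cons, pathElem, pathElem, pathElem_comp p q, mul_assoc]

theorem ghostElem_comp {a b : V} (p : Path a b) : ∀ {c : V} (q : Path b c),
    ghostElem K (p.comp q) = ghostElem K q * ghostElem K p
  | _, Path.nil => (vertex_mul_ghostElem K p).symm
  | _, Path.cons q e => by
    rw [Path.comp_cons, ghostElem, ghostElem, ghostElem_comp p q, mul_assoc]

theorem pathElem_toPath {a b : V} (e : a ⟶ b) :
    pathElem K e.toPath = lgen K (Gen.edge ⟨a, b, e⟩) :=
  lgen_left_mul_edge K ⟨a, b, e⟩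

theorem ghostElem_toPath {a b : V} (e : a ⟶ b) :
    ghostElem K e.toPath = lgen K (Gen.ghost ⟨a, b, e⟩) :=
  lgen_ghost_mul_left K ⟨a, b, e⟩

/-- A nontrivial path begins with an edge. -/
theorem exists_eq_toPath_comp {a b : V} (p : Path a b) (hp : p.length ≠ 0) :
    ∃ (c : V) (e : a ⟶ c) (q : Path c b), p = e.toPath.comp q ∧ p.length = q.length + 1 := by
  obtain ⟨n, hn⟩ := Nat.exists_eq_succ_of_ne_zero hp
  obtain ⟨c, e, q, h, rfl⟩ := p.eq_toPath_comp_of_length_eq_succ hn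
  exact ⟨c, e, q, rfl, by rw [hn, h]⟩

theorem vertex_mem_lpaGrading (x : V) : lgen K (Gen.vertex x) ∈ lpaGrading K V 0 :=
  Submodule.subset_span ⟨x, x, x, Path.nil, Path.nil, by simp, (lgen_vertex_mul_self K x).symm⟩

theorem edge_mem_lpaGrading (e : Total V) : lgen K (Gen.edge e) ∈ lpaGrading K V 1 := by
  refine Submodule.subset_span ⟨_, _, _, e.hom.toPath, Path.nil, by simp, ?_⟩
  rw [pathElem_toPath]
  exact (lgen_edge_mul_right K e).symm

theorem ghost_mem_lpaGrading (e : Total V) : lgen K (Gen.ghost e) ∈ lpaGrading K V (-1) := by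
  refine Submodule.subset_span ⟨_, _, _, Path.nil, e.hom.toPath, by simp, ?_⟩
  rw [ghostElem_toPath]
  exact (lgen_right_mul_ghost K e).symm

/-- The monomials `p q*` span the Leavitt path algebra: their span contains the generators and is
closed under multiplication by generators from the left. -/
theorem span_monomials (x : LeavittPathAlgebra K V) :
    x ∈ Submodule.span K {z | ∃ (a b c : V) (p : Path a c) (q : Path b c),
      z = pathElem K p * ghostElem K q} := by
  set S := Submodule.span K {z | ∃ (a b c : V) (p : Path a c) (q : Path b c),
      z = pathElem K p * ghostElem K q} with hS
  have hsub : ∀ d, lpaGrading K V d ≤ S := fun d => Submodule.span_mono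
    fun z ⟨a, b, c, p, q, _, h⟩ => ⟨a, b, c, p, q, h⟩
  have key : ∀ g : Gen V, ∀ y ∈ S, lgen K g * y ∈ S := by
    intro g y hy
    induction hy using Submodule.span_induction with
    | zero => rw [mul_zero]; exact zero_mem _
    | add x y _ _ h1 h2 => rw [mul_add]; exact add_mem h1 h2
    | smul c x _ h => rw [mul_smul_comm]; exact Submodule.smul_mem _ _ h
    | mem y hy =>
      obtain ⟨a, b, c, p, q, rfl⟩ := hy
      cases g with
      | vertex x =>
        by_cases h : x = a
        · subst h
          rw [← mul_assoc, vertex_mul_pathElem]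
          exact Submodule.subset_span ⟨_, _, _, p, q, rfl⟩
        · rw [← mul_assoc, vertex_mul_pathElem_ne K p h, zero_mul]; exact zero_mem _
      | edge e =>
        obtain ⟨s, r, e⟩ := e
        by_cases h : r = a
        · subst h
          refine Submodule.subset_span ⟨_, _, _, e.toPath.comp p, q, ?_⟩
          rw [pathElem_comp, pathElem_toPath, mul_assoc]
        · have : lgen K (Gen.edge ⟨s, r, e⟩) * pathElem K p = 0 := by
            rw [← lgen_edge_mul_right, mul_assoc, vertex_mul_pathElem_ne K p h, mul_zero]
          rw [← mul_assoc, this, zero_mul]; exact zero_mem _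
      | ghost e =>
        by_cases hp : p.length = 0
        · obtain rfl := Path.eq_of_length_zero p hp
          obtain rfl := Path.eq_nil_of_length_zero p hp
          obtain ⟨s, r, e⟩ := e
          rw [pathElem, vertex_mul_ghostElem]
          by_cases h : s = a
          · subst h
            refine Submodule.subset_span ⟨_, _, _, Path.nil, q.cons e, ?_⟩
            rw [pathElem, vertex_mul_ghostElem, ghostElem]
          · have : lgen K (Gen.ghost ⟨s, r, e⟩) * ghostElem K q = 0 := by
              rw [← vertex_mul_ghostElem, ← mul_assoc, ← lgen_ghost_mul_left,
                mul_assoc (lgen K (Gen.ghost _)), lgen_vertex_mul_ne K h, mul_zero, zero_mul]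
            rw [this]; exact zero_mem _
        · obtain ⟨d, f, p', rfl, _⟩ := exists_eq_toPath_comp p hp
          rw [pathElem_comp, pathElem_toPath, ← mul_assoc, ← mul_assoc]
          by_cases h : e = ⟨a, d, f⟩
          · subst h
            rw [lgen_ghost_mul_edge_self, vertex_mul_pathElem]
            exact Submodule.subset_span ⟨_, _, _, p', q, rfl⟩
          · rw [lgen_ghost_mul_edge_ne K h, zero_mul, zero_mul]; exact zero_mem _
  refine (lpa_induction K (p := fun x => x ∈ S ∧ ∀ y ∈ S, x * y ∈ S) ?_ ?_ ?_ ?_ ?_ x).1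
  · refine fun g => ⟨?_, key g⟩
    cases g with
    | vertex x => exact hsub _ (vertex_mem_lpaGrading K x)
    | edge e => exact hsub _ (edge_mem_lpaGrading K e)
    | ghost e => exact hsub _ (ghost_mem_lpaGrading K e)
  · exact ⟨zero_mem _, fun y _ => by rw [zero_mul]; exact zero_mem _⟩
  · exact fun x y hx hy => ⟨add_mem hx.1 hy.1, fun z hz => by
      rw [add_mul]; exact add_mem (hx.2 z hz) (hy.2 z hz)⟩
  · exact fun x y hx hy => ⟨hx.2 y hy.1, fun z hz => by
      rw [mul_assoc]; exact hx.2 _ (hy.2 z hz)⟩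
  · exact fun c x hx => ⟨Submodule.smul_mem _ _ hx.1, fun z hz => by
      rw [smul_mul_assoc]; exact Submodule.smul_mem _ _ (hx.2 z hz)⟩

end Relations

/-! ### Splitting the identity of a unital Leavitt path algebra -/

section Corner

variable (K : Type w) [Field K] {V : Type u} [Quiver.{v} V]

open scoped Classical in
/-- For a finite set `t` of edges, the element `x - ∑ e e*`, the sum running over the edges `e` in
`t` with source `x`. If `t` contains all the edges which are nonzero in the Leavitt path algebra,
it is the part of the vertex `x` not accounted for by the edges it emits, so that it behaves like a
sink, whether or not `x` is one. -/
noncomputable def sinkPart (t : Finset (Total V)) (x : V) : LeavittPathAlgebra K V :=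
  lgen K (Gen.vertex x) -
    ∑ e ∈ t.filter (fun e => e.left = x), lgen K (Gen.edge e) * lgen K (Gen.ghost e)

theorem lgen_ghost_eq_zero {e : Total V} (h : lgen K (Gen.edge e) = 0) :
    lgen K (Gen.ghost e) = 0 := by
  rw [← lgen_right_mul_ghost, ← lgen_ghost_mul_edge_self, h, mul_zero, zero_mul]

theorem edge_mul_ghost_mul_edge (e : Total V) :
    lgen K (Gen.edge e) * lgen K (Gen.ghost e) * lgen K (Gen.edge e) = lgen K (Gen.edge e) := by
  rw [mul_assoc, lgen_ghost_mul_edge_self, lgen_edge_mul_right]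

theorem ghost_mul_edge_mul_ghost (e : Total V) :
    lgen K (Gen.ghost e) * (lgen K (Gen.edge e) * lgen K (Gen.ghost e)) =
      lgen K (Gen.ghost e) := by
  rw [← mul_assoc, lgen_ghost_mul_edge_self, lgen_right_mul_ghost]

theorem vertex_mul_edge_ne {x : V} {e : Total V} (h : x ≠ e.left) :
    lgen K (Gen.vertex x) * lgen K (Gen.edge e) = 0 := by
  rw [← lgen_left_mul_edge, ← mul_assoc, lgen_vertex_mul_ne K h, zero_mul]

theorem ghost_mul_vertex_ne {x : V} {e : Total V} (h : e.left ≠ x) :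
    lgen K (Gen.ghost e) * lgen K (Gen.vertex x) = 0 := by
  rw [← lgen_ghost_mul_left, mul_assoc, lgen_vertex_mul_ne K h, mul_zero]

variable (t : Finset (Total V))

theorem sinkPart_mul_edge (ht : ∀ e, lgen K (Gen.edge e) ≠ 0 → e ∈ t) (x : V) (e : Total V) :
    sinkPart K t x * lgen K (Gen.edge e) = 0 := by
  classical
  by_cases h0 : lgen K (Gen.edge e) = 0
  · rw [h0, mul_zero]
  have hne : ∀ f : Total V, f ≠ e →
      lgen K (Gen.edge f) * lgen K (Gen.ghost f) * lgen K (Gen.edge e) = 0 := fun f hf => by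
    rw [mul_assoc, lgen_ghost_mul_edge_ne K hf, mul_zero]
  rw [sinkPart, sub_mul (α := LeavittPathAlgebra K V), Finset.sum_mul]
  by_cases h : e.left = x
  · rw [Finset.sum_eq_single_of_mem e (Finset.mem_filter.2 ⟨ht e h0, h⟩) fun f _ hf => hne f hf,
      edge_mul_ghost_mul_edge, ← h, lgen_left_mul_edge, sub_self]
  · rw [vertex_mul_edge_ne K (Ne.symm h), Finset.sum_eq_zero, sub_self]
    intro f hf
    refine hne f ?_
    rintro rfl
    exact h (Finset.mem_filter.1 hf).2

theorem ghost_mul_sinkPart (ht : ∀ e, lgen K (Gen.edge e) ≠ 0 → e ∈ t) (x : V) (e : Total V) :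
    lgen K (Gen.ghost e) * sinkPart K t x = 0 := by
  classical
  by_cases h0 : lgen K (Gen.edge e) = 0
  · rw [lgen_ghost_eq_zero K h0, zero_mul]
  have hne : ∀ f : Total V, f ≠ e →
      lgen K (Gen.ghost e) * (lgen K (Gen.edge f) * lgen K (Gen.ghost f)) = 0 := fun f hf => by
    rw [← mul_assoc, lgen_ghost_mul_edge_ne K hf.symm, zero_mul]
  rw [sinkPart, mul_sub (α := LeavittPathAlgebra K V), Finset.mul_sum]
  by_cases h : e.left = x
  · rw [Finset.sum_eq_single_of_mem e (Finset.mem_filter.2 ⟨ht e h0, h⟩) fun f _ hf => hne f hf,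
      ghost_mul_edge_mul_ghost, ← h, lgen_ghost_mul_left, sub_self]
  · rw [ghost_mul_vertex_ne K h, Finset.sum_eq_zero, sub_self]
    intro f hf
    refine hne f ?_
    rintro rfl
    exact h (Finset.mem_filter.1 hf).2

theorem sinkPart_mul_vertex_self (x : V) :
    sinkPart K t x * lgen K (Gen.vertex x) = sinkPart K t x := by
  classical
  rw [sinkPart, sub_mul (α := LeavittPathAlgebra K V), lgen_vertex_mul_self, Finset.sum_mul]
  congr 1
  refine Finset.sum_congr rfl fun e he => ?_
  rw [← (Finset.mem_filter.1 he).2, mul_assoc, lgen_ghost_mul_left]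

theorem vertex_mul_sinkPart_self (x : V) :
    lgen K (Gen.vertex x) * sinkPart K t x = sinkPart K t x := by
  classical
  rw [sinkPart, mul_sub (α := LeavittPathAlgebra K V), lgen_vertex_mul_self, Finset.mul_sum]
  congr 1
  refine Finset.sum_congr rfl fun e he => ?_
  rw [← (Finset.mem_filter.1 he).2, ← mul_assoc, lgen_left_mul_edge]

theorem sinkPart_mul_vertex_ne {x y : V} (h : x ≠ y) :
    sinkPart K t x * lgen K (Gen.vertex y) = 0 := by
  rw [← sinkPart_mul_vertex_self, mul_assoc, lgen_vertex_mul_ne K h, mul_zero]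

theorem vertex_mul_sinkPart_ne {x y : V} (h : x ≠ y) :
    lgen K (Gen.vertex x) * sinkPart K t y = 0 := by
  rw [← vertex_mul_sinkPart_self, ← mul_assoc, lgen_vertex_mul_ne K h, zero_mul]

/-- Only trivial paths survive between two sink parts. -/
theorem sinkPart_mul_monomial_mul_sinkPart (ht : ∀ e, lgen K (Gen.edge e) ≠ 0 → e ∈ t) (x y : V)
    {a b c : V} (p : Path a c) (q : Path b c) :
    sinkPart K t x * (pathElem K p * ghostElem K q) * sinkPart K t y = 0 ∨
      (p.length = 0 ∧ q.length = 0 ∧ x = y ∧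
      sinkPart K t x * (pathElem K p * ghostElem K q) * sinkPart K t y =
        sinkPart K t x * sinkPart K t y) := by
  by_cases hp : p.length = 0
  · by_cases hq : q.length = 0
    · obtain rfl := Path.eq_of_length_zero p hp
      obtain rfl := Path.eq_nil_of_length_zero p hp
      obtain rfl := Path.eq_of_length_zero q hq
      obtain rfl := Path.eq_nil_of_length_zero q hq
      rw [pathElem, ghostElem, lgen_vertex_mul_self]
      by_cases hx : x = b
      · by_cases hy : b = y
        · subst hx hy
          rw [sinkPart_mul_vertex_self]
          exact Or.inr ⟨rfl, rfl, rfl, rfl⟩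
        · left; rw [mul_assoc, vertex_mul_sinkPart_ne K t hy, mul_zero]
      · left; rw [sinkPart_mul_vertex_ne K t hx, zero_mul]
    · left
      obtain ⟨d, f, q', rfl, _⟩ := exists_eq_toPath_comp q hq
      rw [ghostElem_comp, ghostElem_toPath]
      simp only [mul_assoc]
      rw [ghost_mul_sinkPart K t ht]
      simp only [mul_zero]
  · left
    obtain ⟨d, f, p', rfl, _⟩ := exists_eq_toPath_comp p hp
    rw [pathElem_comp, pathElem_toPath]
    simp only [← mul_assoc]
    rw [sinkPart_mul_edge K t ht]
    simp only [zero_mul]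

theorem sinkPart_mul_mul_sinkPart_eq_zero (ht : ∀ e, lgen K (Gen.edge e) ≠ 0 → e ∈ t) {x y : V}
    {d : ℤ} (h : d ≠ 0 ∨ x ≠ y) {z : LeavittPathAlgebra K V} (hz : z ∈ lpaGrading K V d) :
    sinkPart K t x * z * sinkPart K t y = 0 := by
  induction hz using Submodule.span_induction with
  | zero => rw [mul_zero, zero_mul]
  | add a b _ _ h1 h2 => rw [mul_add, add_mul, h1, h2, add_zero]
  | smul c a _ h => rw [mul_smul_comm, smul_mul_assoc, h, smul_zero]
  | mem z hz =>
    obtain ⟨a, b, c, p, q, hd, rfl⟩ := hz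
    rcases sinkPart_mul_monomial_mul_sinkPart K t ht x y p q with h0 | ⟨hp, hq, hxy, _⟩
    · exact h0
    · rw [hp, hq] at hd
      exact (h.elim (fun h => h (by simpa using hd.symm)) fun h => h hxy).elim

theorem exists_sinkPart_mul_mul_sinkPart_eq_smul (ht : ∀ e, lgen K (Gen.edge e) ≠ 0 → e ∈ t)
    (x : V) {d : ℤ} {z : LeavittPathAlgebra K V} (hz : z ∈ lpaGrading K V d) :
    ∃ c : K, sinkPart K t x * z * sinkPart K t x = c • (sinkPart K t x * sinkPart K t x) := by
  induction hz using Submodule.span_induction with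
  | zero => exact ⟨0, by rw [mul_zero, zero_mul, zero_smul]⟩
  | add a b _ _ h1 h2 =>
    obtain ⟨c, hc⟩ := h1
    obtain ⟨c', hc'⟩ := h2
    exact ⟨c + c', by rw [mul_add, add_mul, hc, hc', add_smul]⟩
  | smul r a _ h =>
    obtain ⟨c, hc⟩ := h
    exact ⟨r * c, by rw [mul_smul_comm, smul_mul_assoc, hc, mul_smul]⟩
  | mem z hz =>
    obtain ⟨a, b, c, p, q, hd, rfl⟩ := hz
    rcases sinkPart_mul_monomial_mul_sinkPart K t ht x x p q with h0 | ⟨_, _, _, h1⟩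
    · exact ⟨0, by rw [h0, zero_smul]⟩
    · exact ⟨1, by rw [h1, one_smul]⟩

end Corner

theorem sum_eq_sum_sub_fiberwise_add_sum {α β M : Type*} [AddCommGroup M] [DecidableEq α]
    (s : Finset α) (t : Finset β) (g : β → α) (p : α → M) (q : β → M) (h : ∀ e ∈ t, g e ∈ s) :
    ∑ x ∈ s, p x = ∑ x ∈ s, (p x - ∑ e ∈ t.filter (fun e => g e = x), q e) + ∑ e ∈ t, q e := by
  rw [Finset.sum_sub_distrib, Finset.sum_fiberwise_of_maps_to h, sub_add_cancel]

/-- If a unital graded algebra, in which there are no infinite families of orthogonal idempotents of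
degree zero, is graded isomorphic to a Leavitt path algebra, its identity is a finite sum of
elements `F x` and of products `X e * Y e` with `X e` of degree `1` and `Y e` of degree `-1`. Here
`F x` comes from the sink part of the vertex `x`, and `X e`, `Y e` from the edge `e` and the ghost
edge `e*`. Between `F x` and `F y` there is nothing unless `x = y`, and the corner at `F x` is
commutative and concentrated in degree zero. -/
theorem exists_one_eq_sum {K : Type w} [Field K] {V : Type u} [Quiver.{v} V]
    {A : Type w} [Ring A] [Module K A] {𝒜 : ℤ → Submodule K A}
    (hfin : ∀ (ι : Type (max u v)) (e : ι → A), (∀ i, e i ∈ 𝒜 0) → (∀ i, e i * e i = e i) →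
      (∀ i j, i ≠ j → e i * e j = 0) → (∀ i, e i ≠ 0) → Finite ι)
    (h : GradedIso (B := LeavittPathAlgebra K V) 𝒜 (lpaGrading K V)) :
    ∃ (s : Finset V) (F : V → A) (t : Finset (Total V)) (X Y : Quiver.Total V → A),
      (∀ e, X e ∈ 𝒜 1) ∧ (∀ e, Y e ∈ 𝒜 (-1)) ∧
      1 = ∑ x ∈ s, F x + ∑ e ∈ t, X e * Y e ∧
      (∀ x y d, d ≠ 0 ∨ x ≠ y → ∀ z ∈ 𝒜 d, F x * z * F y = 0) ∧
      (∀ x, ∀ z ∈ 𝒜 0, ∀ z' ∈ 𝒜 0,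
        (F x * z * F x) * (F x * z' * F x) = (F x * z' * F x) * (F x * z * F x)) := by
  classical
  obtain ⟨f, hf⟩ := h
  have hg : ∀ d y, y ∈ lpaGrading K V d → f.symm y ∈ 𝒜 d := fun d y hy => by
    rw [hf, f.apply_symm_apply]; exact hy
  have hs : {x : V | lgen K (Gen.vertex x) ≠ 0}.Finite := by
    suffices h : Finite (ULift.{max u v} {x : V | lgen K (Gen.vertex x) ≠ 0}) from
      Set.finite_coe_iff.1 (Finite.of_equiv _ Equiv.ulift)
    refine hfin (ULift.{max u v} {x : V | lgen K (Gen.vertex x) ≠ 0})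
      (fun x => f.symm (lgen K (Gen.vertex x.down.1)))
      (fun x => hg _ _ (vertex_mem_lpaGrading K _)) (fun x => ?_) (fun x y hxy => ?_) (fun x => ?_)
    · rw [← map_mul, lgen_vertex_mul_self]
    · rw [← map_mul, lgen_vertex_mul_ne, map_zero]
      exact fun h => hxy (ULift.ext _ _ (Subtype.ext h))
    · rw [Ne, EmbeddingLike.map_eq_zero_iff]; exact x.down.2
  have ht : {e : Total V | lgen K (Gen.edge e) ≠ 0}.Finite := by
    refine Set.finite_coe_iff.1 ?_
    refine hfin {e : Total V | lgen K (Gen.edge e) ≠ 0}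
      (fun e => f.symm (lgen K (Gen.edge e.1) * lgen K (Gen.ghost e.1)))
      (fun e => hg _ _ (Submodule.subset_span
        ⟨_, _, _, e.1.hom.toPath, e.1.hom.toPath, by simp, ?_⟩))
      (fun e => ?_) (fun e e' hne => ?_) (fun e => ?_)
    · rw [pathElem_toPath, ghostElem_toPath]
    · rw [← map_mul, ← mul_assoc, edge_mul_ghost_mul_edge]
    · rw [← map_mul, ← mul_assoc, mul_assoc (lgen K _), lgen_ghost_mul_edge_ne, mul_zero, zero_mul,
        map_zero]
      exact fun h => hne (Subtype.ext h)
    · rw [Ne, EmbeddingLike.map_eq_zero_iff]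
      intro h0
      exact e.2 (by rw [← edge_mul_ghost_mul_edge, h0, zero_mul])
  have hs' : ∀ x, lgen K (Gen.vertex x) ≠ 0 → x ∈ hs.toFinset := fun x hx => by simpa using hx
  have ht' : ∀ e, lgen K (Gen.edge e) ≠ 0 → e ∈ ht.toFinset := fun e he => by simpa using he
  -- The sum of the nonzero vertices is a left identity.
  have hvert : ∀ x : V, (∑ y ∈ hs.toFinset, lgen K (Gen.vertex y)) * lgen K (Gen.vertex x) =
      lgen K (Gen.vertex x) := fun x => by
    by_cases h0 : lgen K (Gen.vertex x) = 0
    · rw [h0, mul_zero]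
    rw [Finset.sum_mul, Finset.sum_eq_single_of_mem x (hs' x h0), lgen_vertex_mul_self]
    exact fun y _ hy => lgen_vertex_mul_ne K hy
  have hleft : ∀ z, (∑ y ∈ hs.toFinset, lgen K (Gen.vertex y)) * z = z := by
    intro z
    refine lpa_induction K (p := fun z => _ * z = z) ?_ ?_ ?_ ?_ ?_ z
    · rintro (x | e | e)
      · exact hvert x
      · rw [← lgen_left_mul_edge, ← mul_assoc, hvert]
      · rw [← lgen_right_mul_ghost, ← mul_assoc, hvert]
    · rw [mul_zero]
    · intro x y hx hy
      rw [mul_add, hx, hy]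
    · intro x y hx _
      rw [← mul_assoc, hx]
    · intro c x hx
      rw [mul_smul_comm, hx]
  have hone : (1 : A) = f.symm (∑ y ∈ hs.toFinset, lgen K (Gen.vertex y)) := by
    have := congrArg f.symm (hleft (f 1))
    rwa [map_mul, f.symm_apply_apply, mul_one, eq_comm] at this
  have hsum : ∑ y ∈ hs.toFinset, lgen K (Gen.vertex y) =
      ∑ x ∈ hs.toFinset, sinkPart K ht.toFinset x +
        ∑ e ∈ ht.toFinset, lgen K (Gen.edge e) * lgen K (Gen.ghost e) := by
    refine sum_eq_sum_sub_fiberwise_add_sum (M := LeavittPathAlgebra K V) hs.toFinset ht.toFinset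
      Total.left _ _ fun e he => ?_
    refine hs' _ fun h0 => ?_
    have he : lgen K (Gen.edge e) ≠ 0 := by simpa using he
    exact he (by rw [← lgen_left_mul_edge, h0, zero_mul])
  refine ⟨hs.toFinset, fun x => f.symm (sinkPart K ht.toFinset x), ht.toFinset,
    fun e => f.symm (lgen K (Gen.edge e)), fun e => f.symm (lgen K (Gen.ghost e)),
    fun e => hg _ _ (edge_mem_lpaGrading K e), fun e => hg _ _ (ghost_mem_lpaGrading K e),
    ?_, ?_, ?_⟩
  · rw [hone, hsum]
    simp only [map_add, map_sum, map_mul]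
  · intro x y d hd z hz
    have := sinkPart_mul_mul_sinkPart_eq_zero K ht.toFinset ht' hd ((hf d z).1 hz)
    have := congrArg f.symm this
    simpa only [map_mul, f.symm_apply_apply, map_zero] using this
  · intro x z hz z' hz'
    obtain ⟨c, hc⟩ := exists_sinkPart_mul_mul_sinkPart_eq_smul K ht.toFinset ht' x ((hf 0 z).1 hz)
    obtain ⟨c', hc'⟩ :=
      exists_sinkPart_mul_mul_sinkPart_eq_smul K ht.toFinset ht' x ((hf 0 z').1 hz')
    apply f.injective
    simp only [map_mul, f.apply_symm_apply, hc, hc', smul_mul_smul_comm, mul_comm c c']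

/-! ### Homogeneous elements of graded matrix algebras -/

section Components

variable {K : Type w} [Field K]

theorem eq_zero_of_mem_trivialGrading {d : ℤ} {x : K} (hx : x ∈ trivialGrading K d) (hd : d ≠ 0) :
    x = 0 := by
  rwa [trivialGrading, if_neg hd, Submodule.mem_bot] at hx

theorem mem_trivialGrading_of_eq {d : ℤ} (hd : d = 0) (x : K) : x ∈ trivialGrading K d := by
  rw [trivialGrading, if_pos hd]; trivial

theorem mem_laurentGrading_iff {m : ℕ} {d : ℤ} {x : K[T;T⁻¹]} :
    x ∈ laurentGrading K m d ↔ ∀ i, x.coeff i ≠ 0 → (m : ℤ) * i = d := by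
  refine forall_congr' fun i => ?_
  rw [Finsupp.mem_support_iff]

theorem T_mem_laurentGrading {m : ℕ} {d : ℤ} (i : ℤ) (h : (m : ℤ) * i = d) :
    (LaurentPolynomial.T i : K[T;T⁻¹]) ∈ laurentGrading K m d := by
  subst h
  exact AddMonoidAlgebra.single_mem_gradeBy _ _ _

theorem eq_zero_of_mem_laurentGrading {m : ℕ} {d : ℤ} {x : K[T;T⁻¹]}
    (hx : x ∈ laurentGrading K m d) (hd : ¬ (m : ℤ) ∣ d) : x = 0 := by
  ext i
  by_contra h
  exact hd ⟨i, (mem_laurentGrading_iff.1 hx i h).symm⟩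

theorem mul_single_mul_apply {ι A : Type*} [Fintype ι] [DecidableEq ι] [Ring A]
    (M N : Matrix ι ι A) (a b c d : ι) (p : A) :
    (M * Matrix.single a b p * N) c d = M c a * p * N b d := by
  rw [Matrix.mul_apply, Finset.sum_eq_single b]
  · rw [Matrix.mul_single_apply_same]
  · intro e _ he
    rw [Matrix.mul_single_apply_of_ne _ _ _ _ _ he, zero_mul]
  · simp

variable {k n : ℕ} {I : Fin k → Type} {J : Fin n → Type}

variable (K I J) in
/-- The matrix unit with a single entry at `(a, b)`, in the block `i` of matrices over `K`. -/
noncomputable def unitK [∀ i, DecidableEq (I i)] (i : Fin k) (a b : I i) : MatrixSum K I J :=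
  (Pi.single i (Matrix.single a b 1), 0)

variable (K I J) in
/-- The matrix with the single entry `T ^ c` at `(a, b)`, in the block `j` of matrices over
`K[T, T⁻¹]`. -/
noncomputable def unitL [∀ j, DecidableEq (J j)] (j : Fin n) (a b : J j) (c : ℤ) :
    MatrixSum K I J :=
  (0, Pi.single j (Matrix.single a b (LaurentPolynomial.T c)))

theorem unitK_fst [∀ i, DecidableEq (I i)] (i : Fin k) (a b : I i) :
    (unitK K I J i a b).1 i = Matrix.single a b 1 :=
  Pi.single_eq_same _ _

theorem unitL_snd [∀ j, DecidableEq (J j)] (j : Fin n) (a b : J j) (c : ℤ) :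
    (unitL K I J j a b c).2 j = Matrix.single a b (LaurentPolynomial.T c) :=
  Pi.single_eq_same _ _

theorem single_mem_matrixGrading {A : Type*} {ι : Type} [Ring A] [Module K A] [DecidableEq ι]
    {𝒜 : ℤ → Submodule K A} {γ : ι → ℤ} {d : ℤ} {a b : ι} {p : A}
    (hp : p ∈ 𝒜 (-γ a + d + γ b)) : Matrix.single a b p ∈ matrixGrading 𝒜 γ d := by
  intro x y
  rw [Matrix.single_apply]
  split_ifs with h
  · rw [← h.1, ← h.2]; exact hp
  · exact zero_mem _

variable {γ : ∀ i, I i → ℤ} {m : Fin n → ℕ} {δ : ∀ j, J j → ℤ}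

theorem unitK_mem [∀ i, DecidableEq (I i)] {i : Fin k} {a b : I i} {d : ℤ} (h : γ i a - γ i b = d) :
    unitK K I J i a b ∈ matrixSumGrading K γ m δ d := by
  refine ⟨fun i' => ?_, fun j => zero_mem _⟩
  by_cases hi : i' = i
  · subst hi
    rw [unitK_fst]
    exact single_mem_matrixGrading (mem_trivialGrading_of_eq (by omega) _)
  · have h0 : (unitK K I J i a b).1 i' = 0 := Pi.single_eq_of_ne hi _
    rw [h0]; exact zero_mem _

theorem unitL_mem [∀ j, DecidableEq (J j)] {j : Fin n} {a b : J j} {c d : ℤ}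
    (h : δ j a - δ j b + m j * c = d) :
    unitL K I J j a b c ∈ matrixSumGrading K γ m δ d := by
  refine ⟨fun i => zero_mem _, fun j' => ?_⟩
  by_cases hj : j' = j
  · subst hj
    rw [unitL_snd]
    exact single_mem_matrixGrading (T_mem_laurentGrading _ (by omega))
  · have h0 : (unitL K I J j a b c).2 j' = 0 := Pi.single_eq_of_ne hj _
    rw [h0]; exact zero_mem _

theorem fst_apply_eq_zero {d : ℤ} {x : MatrixSum K I J} (hx : x ∈ matrixSumGrading K γ m δ d)
    {i : Fin k} {a b : I i} (h : γ i a - γ i b ≠ d) : x.1 i a b = 0 :=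
  eq_zero_of_mem_trivialGrading (hx.1 i a b) (by omega)

theorem snd_apply_eq_zero {d : ℤ} {x : MatrixSum K I J} (hx : x ∈ matrixSumGrading K γ m δ d)
    {j : Fin n} {a b : J j} (h : ¬ (m j : ℤ) ∣ -δ j a + d + δ j b) : x.2 j a b = 0 :=
  eq_zero_of_mem_laurentGrading (hx.2 j a b) h

end Components

section Finiteness

variable {K : Type w} [Field K] {k n : ℕ} {I : Fin k → Type} {J : Fin n → Type}
  {γ : ∀ i, I i → ℤ} {m : Fin n → ℕ} {δ : ∀ j, J j → ℤ}

variable (K I m δ) in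
/-- The coefficients of the homogeneous component of degree zero. -/
noncomputable def degreeZeroCoeff :
    MatrixSum K I J →ₗ[K] (∀ i, I i → I i → K) × (∀ j, J j → J j → K) where
  toFun x := (fun i a b => x.1 i a b,
    fun j a b => (x.2 j a b).coeff ((-δ j a + δ j b) / (m j : ℤ)))
  map_add' _ _ := rfl
  map_smul' _ _ := rfl

theorem degreeZeroCoeff_injOn (hm : ∀ j, 0 < m j) :
    Set.InjOn (degreeZeroCoeff K I m δ) (matrixSumGrading K γ m δ 0) := by
  intro x hx y hy hxy
  have h1 := congrArg Prod.fst hxy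
  have h2 := congrArg Prod.snd hxy
  have aux : ∀ z ∈ matrixSumGrading K γ m δ 0, ∀ j a b i,
      i ≠ (-δ j a + δ j b) / (m j : ℤ) → (z.2 j a b).coeff i = 0 := by
    intro z hz j a b i hi
    by_contra hne
    have := mem_laurentGrading_iff.1 (hz.2 j a b) i hne
    apply hi
    rw [add_zero] at this
    rw [← this, Int.mul_ediv_cancel_left]
    have := hm j
    omega
  refine Prod.ext ?_ ?_
  · funext i
    ext a b
    exact congrFun (congrFun (congrFun h1 i) a) b
  · funext j
    ext a b i
    by_cases hi : i = (-δ j a + δ j b) / (m j : ℤ)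
    · subst hi
      exact congrFun (congrFun (congrFun h2 j) a) b
    · rw [aux x hx j a b i hi, aux y hy j a b i hi]

/-- Orthogonal nonzero idempotents are linearly independent, and the component of degree zero is
finite-dimensional. -/
theorem finite_of_orthogonal_idempotents [∀ i, Fintype (I i)] [∀ j, Fintype (J j)]
    (hm : ∀ j, 0 < m j) {ι : Type*} (e : ι → MatrixSum K I J)
    (h0 : ∀ i, e i ∈ matrixSumGrading K γ m δ 0) (hid : ∀ i, e i * e i = e i)
    (hort : ∀ i j, i ≠ j → e i * e j = 0) (hne : ∀ i, e i ≠ 0) : Finite ι := by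
  have hli : LinearIndependent K e := by
    rw [linearIndependent_iff']
    intro s g hg i hi
    have := congrArg (· * e i) hg
    simp only [Finset.sum_mul, zero_mul, smul_mul_assoc] at this
    rw [Finset.sum_eq_single_of_mem i hi, hid] at this
    · exact (smul_eq_zero.1 this).resolve_right (hne i)
    · intro j _ hj
      rw [hort j i hj, smul_zero]
  have hle : Submodule.span K (Set.range e) ≤ matrixSumGrading K γ m δ 0 := by
    rw [Submodule.span_le]
    rintro _ ⟨i, rfl⟩
    exact h0 i
  exact (hli.map_injOn (degreeZeroCoeff K I m δ) ((degreeZeroCoeff_injOn hm).mono hle)).finite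

end Finiteness

/-! ### Shifts of a Leavitt path algebra have no gaps -/

section Predecessors

variable {K : Type w} [Field K] {k n : ℕ} {I : Fin k → Type} {J : Fin n → Type}
  [∀ i, Fintype (I i)] [∀ j, Fintype (J j)] [∀ i, DecidableEq (I i)] [∀ j, DecidableEq (J j)]
  {γ : ∀ i, I i → ℤ} {m : Fin n → ℕ} {δ : ∀ j, J j → ℤ}
  {V : Type u} [Quiver.{v} V]

/-- In a block of matrices over `K`, at most one index `a` has no index whose shift is one less than
that of `a`. An index `a` without such a predecessor is not reached by the products `X e * Y e`, so
its matrix unit is seen by some `F x`. The corner at `F x` is commutative and concentrated in degree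
zero, so it has room for only one such index. -/
theorem eq_of_no_predecessor (hm : ∀ j, 0 < m j)
    (h : GradedIso (B := LeavittPathAlgebra K V) (matrixSumGrading K γ m δ) (lpaGrading K V))
    (i : Fin k) (a b : I i) (ha : ∀ c, γ i c ≠ γ i a - 1) (hb : ∀ c, γ i c ≠ γ i b - 1) :
    a = b := by
  obtain ⟨s, F, t, X, Y, hX, hY, hone, hF, hcomm⟩ := exists_one_eq_sum
    (fun ι e h0 hid hort hne => finite_of_orthogonal_idempotents hm e h0 hid hort hne) h
  have hone' : ∀ c d, (1 : Matrix (I i) (I i) K) c d =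
      ∑ x ∈ s, (F x).1 i c d + ∑ e ∈ t, ∑ y, (X e).1 i c y * (Y e).1 i y d := by
    intro c d
    have := congrFun (congrFun (congrFun (congrArg Prod.fst hone) i) c) d
    rw [Prod.fst_one, Pi.one_apply] at this
    rw [this]
    simp [Prod.fst_sum, Finset.sum_apply, Matrix.sum_apply, Matrix.mul_apply]
  have hrow : ∀ c, (∀ d, γ i d ≠ γ i c - 1) → ∀ d,
      (1 : Matrix (I i) (I i) K) c d = ∑ x ∈ s, (F x).1 i c d := by
    intro c hc d
    rw [hone', add_eq_left]
    refine Finset.sum_eq_zero fun e _ => Finset.sum_eq_zero fun y _ => ?_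
    rw [fst_apply_eq_zero (hX e), zero_mul]
    have := hc y
    omega
  have hcol : ∀ c, (∀ d, γ i d ≠ γ i c - 1) → ∀ d,
      (1 : Matrix (I i) (I i) K) d c = ∑ x ∈ s, (F x).1 i d c := by
    intro c hc d
    rw [hone', add_eq_left]
    refine Finset.sum_eq_zero fun e _ => Finset.sum_eq_zero fun y _ => ?_
    rw [fst_apply_eq_zero (hY e), mul_zero]
    have := hc y
    omega
  have hex : ∀ c, (∀ d, γ i d ≠ γ i c - 1) → ∃ x ∈ s, (F x).1 i c c ≠ 0 := by
    intro c hc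
    refine Finset.exists_ne_zero_of_sum_ne_zero ?_
    rw [← hrow c hc, Matrix.one_apply_eq]
    exact one_ne_zero
  -- The corner from `F y` to `F x`, seen on entries.
  have hcorner : ∀ x y p q r r', x ≠ y ∨ γ i p ≠ γ i q →
      (F x).1 i r p * (F y).1 i q r' = 0 := by
    intro x y p q r r' hne
    have h1 := hF x y (γ i p - γ i q)
      (hne.symm.imp_left sub_ne_zero.2) (unitK K I J i p q) (unitK_mem rfl)
    have h2 := congrFun (congrFun (congrFun (congrArg Prod.fst h1) i) r) r'
    have h3 : ((F x).1 i * (unitK K I J i p q).1 i * (F y).1 i) r r' = 0 := h2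
    rwa [unitK_fst, mul_single_mul_apply, mul_one] at h3
  obtain ⟨x, hxs, hx⟩ := hex a ha
  obtain ⟨y, hys, hy⟩ := hex b hb
  have hxy : x = y ∧ γ i a = γ i b := by
    by_contra hne
    have := hcorner x y a b a b (by tauto)
    rcases mul_eq_zero.1 this with h0 | h0
    · exact hx h0
    · exact hy h0
  obtain ⟨rfl, hγ⟩ := hxy
  -- `F x` agrees with the identity on the rows and columns of `a` and `b`.
  have hrow' : ∀ c, (∀ d, γ i d ≠ γ i c - 1) → (F x).1 i c c ≠ 0 → ∀ d,
      (F x).1 i c d = (1 : Matrix (I i) (I i) K) c d := by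
    intro c hc hcc d
    rw [hrow c hc, Finset.sum_eq_single_of_mem x hxs]
    intro y _ hy
    exact (mul_eq_zero.1 (hcorner x y c c c d (Or.inl hy.symm))).resolve_left hcc
  have hcol' : ∀ c, (∀ d, γ i d ≠ γ i c - 1) → (F x).1 i c c ≠ 0 → ∀ d,
      (F x).1 i d c = (1 : Matrix (I i) (I i) K) d c := by
    intro c hc hcc d
    rw [hcol c hc, Finset.sum_eq_single_of_mem x hxs]
    intro y _ hy
    exact (mul_eq_zero.1 (hcorner y x c c d c (Or.inl hy))).resolve_right hcc
  have hsand : ∀ c d, (∀ e, γ i e ≠ γ i c - 1) → (F x).1 i c c ≠ 0 →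
      (∀ e, γ i e ≠ γ i d - 1) → (F x).1 i d d ≠ 0 →
      (F x * unitK K I J i c d * F x).1 i = Matrix.single c d 1 := by
    intro c d hc hcc hd hdd
    have h1 : (F x * unitK K I J i c d * F x).1 i =
        (F x).1 i * (unitK K I J i c d).1 i * (F x).1 i := rfl
    rw [h1, unitK_fst]
    ext r r'
    rw [mul_single_mul_apply, hcol' c hc hcc, hrow' d hd hdd, mul_one, Matrix.one_apply,
      Matrix.one_apply, Matrix.single_apply]
    by_cases hr : r = c <;> by_cases hr' : d = r' <;> simp [hr, hr', eq_comm (a := c)]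
  have h1 := hcomm x (unitK K I J i a b) (unitK_mem (by omega)) (unitK K I J i b a)
    (unitK_mem (by omega))
  have h2 : (F x * unitK K I J i a b * F x).1 i * (F x * unitK K I J i b a * F x).1 i =
      (F x * unitK K I J i b a * F x).1 i * (F x * unitK K I J i a b * F x).1 i :=
    congrFun (congrArg Prod.fst h1) i
  rw [hsand a b ha hx hb hy, hsand b a hb hy ha hx, Matrix.single_mul_single_same,
    Matrix.single_mul_single_same, mul_one] at h2
  by_contra hne
  have := congrFun (congrFun h2 a) a
  rw [Matrix.single_apply_same, Matrix.single_apply_of_row_ne (Ne.symm hne)] at this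
  exact one_ne_zero this

/-- In a block of matrices over `K[x^m, x^{-m}]`, the shifts are closed under subtracting one
modulo `m`: otherwise the corner at some `F x` would contain a nonzero element of degree `m`. -/
theorem exists_predecessor_mod (hm : ∀ j, 0 < m j)
    (h : GradedIso (B := LeavittPathAlgebra K V) (matrixSumGrading K γ m δ) (lpaGrading K V))
    (j : Fin n) (a : J j) : ∃ c, (m j : ℤ) ∣ δ j c - (δ j a - 1) := by
  by_contra! ha
  obtain ⟨s, F, t, X, Y, hX, hY, hone, hF, -⟩ := exists_one_eq_sum
    (fun ι e h0 hid hort hne => finite_of_orthogonal_idempotents hm e h0 hid hort hne) h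
  have hone' : (1 : Matrix (J j) (J j) K[T;T⁻¹]) a a =
      ∑ x ∈ s, (F x).2 j a a + ∑ e ∈ t, ∑ y, (X e).2 j a y * (Y e).2 j y a := by
    have := congrFun (congrFun (congrFun (congrArg Prod.snd hone) j) a) a
    rw [Prod.snd_one, Pi.one_apply] at this
    rw [this]
    simp [Prod.snd_sum, Finset.sum_apply, Matrix.sum_apply, Matrix.mul_apply]
  have h0 : ∑ e ∈ t, ∑ y, (X e).2 j a y * (Y e).2 j y a = 0 := by
    refine Finset.sum_eq_zero fun e _ => Finset.sum_eq_zero fun y _ => ?_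
    rw [snd_apply_eq_zero (hX e), zero_mul]
    have := ha y
    rwa [show -δ j a + 1 + δ j y = δ j y - (δ j a - 1) by ring]
  rw [h0, add_zero, Matrix.one_apply_eq] at hone'
  obtain ⟨x, _, hx⟩ := Finset.exists_ne_zero_of_sum_ne_zero
    (hone' ▸ one_ne_zero : ∑ x ∈ s, (F x).2 j a a ≠ 0)
  have hmj := hm j
  have h1 := hF x x (m j) (Or.inl (by omega)) (unitL K I J j a a 1) (unitL_mem (by simp))
  have h2 : ((F x).2 j * (unitL K I J j a a 1).2 j * (F x).2 j) a a = 0 :=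
    congrFun (congrFun (congrFun (congrArg Prod.snd h1) j) a) a
  rw [unitL_snd, mul_single_mul_apply, mul_right_comm, mul_eq_zero] at h2
  rcases h2 with h2 | h2
  · exact hx (mul_self_eq_zero.1 h2)
  · exact (LaurentPolynomial.isUnit_T (R := K) 1).ne_zero h2

end Predecessors

/-! ### Graded isomorphisms of matrix algebras -/

section GradedIsos

theorem gradedIso_refl {K : Type w} [Field K] {A : Type u} [NonUnitalRing A] [Module K A]
    (𝒜 : ℤ → Submodule K A) : GradedIso 𝒜 𝒜 :=
  ⟨RingEquiv.refl A, fun _ _ => Iff.rfl⟩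

theorem gradedIso_symm {K : Type w} [Field K] {A : Type u} {B : Type v} [NonUnitalRing A]
    [NonUnitalRing B] [Module K A] [Module K B] {𝒜 : ℤ → Submodule K A} {ℬ : ℤ → Submodule K B}
    (h : GradedIso 𝒜 ℬ) : GradedIso ℬ 𝒜 := by
  obtain ⟨f, hf⟩ := h
  exact ⟨f.symm, fun d x => by rw [hf, f.apply_symm_apply]⟩

theorem gradedIso_trans {K : Type w} [Field K] {A : Type*} {B : Type*} {C : Type*}
    [NonUnitalRing A] [NonUnitalRing B] [NonUnitalRing C] [Module K A] [Module K B] [Module K C]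
    {𝒜 : ℤ → Submodule K A} {ℬ : ℤ → Submodule K B} {𝒞 : ℤ → Submodule K C}
    (h : GradedIso 𝒜 ℬ) (h' : GradedIso ℬ 𝒞) : GradedIso 𝒜 𝒞 := by
  obtain ⟨f, hf⟩ := h
  obtain ⟨g, hg⟩ := h'
  exact ⟨f.trans g, fun d x => (hf d x).trans (hg d (f x))⟩

variable {K : Type w} [Field K]

theorem gradedIso_matrixSum {k n : ℕ} {I I' : Fin k → Type} {J J' : Fin n → Type}
    [∀ i, Fintype (I i)] [∀ j, Fintype (J j)] [∀ i, Fintype (I' i)] [∀ j, Fintype (J' j)]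
    {γ : ∀ i, I i → ℤ} {γ' : ∀ i, I' i → ℤ} {m : Fin n → ℕ} {δ : ∀ j, J j → ℤ}
    {δ' : ∀ j, J' j → ℤ}
    (h1 : ∀ i, GradedIso (matrixGrading (trivialGrading K) (γ i))
      (matrixGrading (trivialGrading K) (γ' i)))
    (h2 : ∀ j, GradedIso (matrixGrading (laurentGrading K (m j)) (δ j))
      (matrixGrading (laurentGrading K (m j)) (δ' j))) :
    GradedIso (matrixSumGrading K γ m δ) (matrixSumGrading K γ' m δ') := by
  choose f hf using h1
  choose g hg using h2
  refine ⟨RingEquiv.prodCongr (RingEquiv.piCongrRight f) (RingEquiv.piCongrRight g), ?_⟩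
  exact fun d x => and_congr (forall_congr' fun i => hf i d (x.1 i))
    (forall_congr' fun j => hg j d (x.2 j))

/-- Reindexing a matrix, and subtracting a constant from all the shifts. -/
theorem gradedIso_reindex {A : Type*} [Ring A] [Module K A] (𝒜 : ℤ → Submodule K A)
    {ι ι' : Type} [Fintype ι] [Fintype ι'] (e : ι' ≃ ι)
    {γ : ι → ℤ} {γ' : ι' → ℤ} (c : ℤ) (h : ∀ x, γ' x = γ (e x) - c) :
    GradedIso (matrixGrading 𝒜 γ) (matrixGrading 𝒜 γ') := by
  refine ⟨Matrix.reindexRingEquiv A e.symm, fun d M => ?_⟩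
  constructor
  · intro hM x y
    have := hM (e x) (e y)
    rwa [show -γ (e x) + d + γ (e y) = -γ' x + d + γ' y by rw [h, h]; ring] at this
  · intro hM a b
    obtain ⟨x, rfl⟩ := e.surjective a
    obtain ⟨y, rfl⟩ := e.surjective b
    have := hM x y
    rwa [show -γ' x + d + γ' y = -γ (e x) + d + γ (e y) by rw [h, h]; ring] at this

theorem T_mul_mem_laurentGrading {m : ℕ} {d d' : ℤ} {x : K[T;T⁻¹]}
    (hx : x ∈ laurentGrading K m d) (q : ℤ) (h : d + m * q = d') :
    LaurentPolynomial.T q * x ∈ laurentGrading K m d' := by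
  rw [mem_laurentGrading_iff] at hx ⊢
  intro i hi
  have : (LaurentPolynomial.T q * x).coeff i = x.coeff (-q + i) := by
    have := AddMonoidAlgebra.coeff_single_mul_apply x (1 : K) q i
    rwa [one_mul] at this
  rw [this] at hi
  have := hx _ hi
  rw [← h, ← this]
  ring

/-- Conjugation by the diagonal matrix with the entries `T ^ (- q a)`. -/
noncomputable def twist {ι : Type} [Fintype ι] (q : ι → ℤ) :
    Matrix ι ι K[T;T⁻¹] ≃+* Matrix ι ι K[T;T⁻¹] where
  toFun M := Matrix.of fun a b => LaurentPolynomial.T (q b - q a) * M a b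
  invFun M := Matrix.of fun a b => LaurentPolynomial.T (q a - q b) * M a b
  left_inv M := by
    ext1 a b
    simp only [Matrix.of_apply, ← mul_assoc, ← LaurentPolynomial.T_add]
    rw [sub_add_sub_cancel, sub_self, LaurentPolynomial.T_zero, one_mul]
  right_inv M := by
    ext1 a b
    simp only [Matrix.of_apply, ← mul_assoc, ← LaurentPolynomial.T_add]
    rw [sub_add_sub_cancel, sub_self, LaurentPolynomial.T_zero, one_mul]
  map_mul' M N := by
    ext1 a b
    simp only [Matrix.of_apply, Matrix.mul_apply, Finset.mul_sum]
    refine Finset.sum_congr rfl fun c _ => ?_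
    rw [mul_mul_mul_comm, ← LaurentPolynomial.T_add, add_comm, sub_add_sub_cancel]
  map_add' M N := by
    ext1 a b
    simp only [Matrix.of_apply, Matrix.add_apply, mul_add]

/-- Adding multiples of `m` to the shifts. -/
theorem gradedIso_twist {m : ℕ} {ι : Type} [Fintype ι] {γ γ' : ι → ℤ} (q : ι → ℤ)
    (h : ∀ a, γ' a = γ a + m * q a) :
    GradedIso (matrixGrading (laurentGrading K m) γ) (matrixGrading (laurentGrading K m) γ') := by
  refine ⟨twist q, fun d M => ⟨fun hM a b => ?_, fun hM a b => ?_⟩⟩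
  · refine T_mul_mem_laurentGrading (hM a b) _ ?_
    rw [h, h]; ring
  · have := T_mul_mem_laurentGrading (d' := -γ a + d + γ b) (hM a b) (q a - q b)
      (by rw [h, h]; ring)
    rw [← (twist (K := K) q).symm_apply_apply M]
    exact this

end GradedIsos

/-! ### Representatives -/

section Representatives

/-- Sorting a list with entries in `{0, …, r - 1}`. -/
theorem exists_blocks_equiv {n r : ℕ} (g : Fin n → Fin r) (l : Fin r → ℕ)
    (hl : ∀ t, l t = (Finset.univ.filter fun a => g a = t).card) :
    ∃ e : Blocks l ≃ Fin n, ∀ x, g (e x) = x.1 := by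
  refine ⟨(Equiv.sigmaCongrRight fun t => (Fintype.equivFinOfCardEq (α := {a // g a = t})
    ((Fintype.card_subtype _).trans (hl t).symm)).symm).trans (Equiv.sigmaFiberEquiv g), ?_⟩
  rintro ⟨t, x⟩
  exact ((Fintype.equivFinOfCardEq (α := {a // g a = t})
    ((Fintype.card_subtype _).trans (hl t).symm)).symm x).2

theorem eq_sum_of_blocks_equiv {n r : ℕ} {l : Fin r → ℕ} (e : Blocks l ≃ Fin n) :
    n = ∑ t, l t := by
  have := Fintype.card_congr e
  rw [Fintype.card_sigma, Fintype.card_fin] at this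
  rw [← this]
  simp

variable {K : Type w} [Field K]

/-- Representatives exist, and the sorted list they describe gives a graded isomorphic algebra. -/
theorem exists_isRepresentatives {n : ℕ} (hn : 0 < n) (γ : Fin n → ℤ) :
    ∃ (k : ℕ) (l : Fin (k + 1) → ℕ), IsRepresentatives K γ k l ∧ n = ∑ t, l t ∧
      GradedIso (matrixGrading (trivialGrading K) γ)
        (matrixGrading (trivialGrading K) (blockShifts l)) := by
  have : Nonempty (Fin n) := ⟨⟨0, hn⟩⟩
  obtain ⟨a, ha⟩ := Finite.exists_min γ
  obtain ⟨b, hb⟩ := Finite.exists_max γ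
  have hk : ((γ b - γ a).toNat : ℤ) = γ b - γ a := Int.toNat_of_nonneg (by linarith [ha b])
  have hlt : ∀ j, (γ j - γ a).toNat < (γ b - γ a).toNat + 1 := fun j => by
    have := ha j
    have := hb j
    omega
  obtain ⟨e, he⟩ := exists_blocks_equiv
    (fun j => (⟨(γ j - γ a).toNat, hlt j⟩ : Fin ((γ b - γ a).toNat + 1))) _ (fun _ => rfl)
  refine ⟨(γ b - γ a).toNat, _, ⟨γ, gradedIso_refl _, γ a, ?_, ?_, fun t => ?_⟩,
    eq_sum_of_blocks_equiv e, gradedIso_reindex _ e (γ a) fun x => ?_⟩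
  · refine ⟨⟨a, rfl⟩, ?_⟩
    rintro _ ⟨j, rfl⟩
    exact ha j
  · rw [hk]
    refine ⟨⟨b, rfl⟩, ?_⟩
    rintro _ ⟨j, rfl⟩
    exact sub_le_sub_right (hb j) _
  · congr 1
    ext j
    have := ha j
    simp only [Finset.mem_filter, Finset.mem_univ, true_and, Fin.ext_iff]
    omega
  · have h1 := congrArg Fin.val (he x)
    have h2 := ha (e x)
    simp only [blockShifts] at h1 ⊢
    omega

theorem exists_isLaurentRepresentatives {m n : ℕ} (hm : 0 < m) (δ : Fin n → ℤ) :
    ∃ l : Fin m → ℕ, IsLaurentRepresentatives K m δ l ∧ n = ∑ t, l t ∧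
      GradedIso (matrixGrading (laurentGrading K m) δ)
        (matrixGrading (laurentGrading K m) (blockShifts l)) := by
  have hm0 : (m : ℤ) ≠ 0 := by omega
  have hlt : ∀ j, (δ j % (m : ℤ)).toNat < m := fun j => by
    have := Int.emod_lt_of_pos (δ j) (show (0 : ℤ) < m by omega)
    omega
  obtain ⟨e, he⟩ := exists_blocks_equiv
    (fun j => (⟨(δ j % (m : ℤ)).toNat, hlt j⟩ : Fin m)) _ (fun _ => rfl)
  refine ⟨_, ⟨δ, gradedIso_refl _, fun t => ?_⟩, eq_sum_of_blocks_equiv e,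
    gradedIso_trans (gradedIso_twist (γ' := fun j => δ j % (m : ℤ)) (fun j => -(δ j / m)) ?_)
      (gradedIso_reindex _ e 0 fun x => ?_)⟩
  · congr 1
    ext j
    have := Int.emod_nonneg (δ j) hm0
    simp only [Finset.mem_filter, Finset.mem_univ, true_and, Fin.ext_iff]
    omega
  · intro j
    have := Int.emod_add_mul_ediv (δ j) m
    linarith
  · have h1 := congrArg Fin.val (he x)
    have h2 := Int.emod_nonneg (δ (e x)) hm0
    simp only [blockShifts] at h1 ⊢
    omega

/-- If only one index has no predecessor, it is the one with the smallest shift, and going down from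
the largest shift meets all the shifts in between. -/
theorem card_filter_of_no_gap {n : ℕ} {γ : Fin n → ℤ}
    (h : ∀ a b, (∀ c, γ c ≠ γ a - 1) → (∀ c, γ c ≠ γ b - 1) → a = b) {k : ℕ} {c : ℤ}
    (hc : IsLeast (Set.range γ) c) (hk : IsGreatest (Set.range fun j => γ j - c) (k : ℤ))
    (l : Fin (k + 1) → ℕ)
    (hl : ∀ t, l t = (Finset.univ.filter fun j => γ j - c = ((t : ℕ) : ℤ)).card) :
    l 0 = 1 ∧ ∀ t, 0 < l t := by
  obtain ⟨⟨a, rfl⟩, ha⟩ := hc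
  have hmin : ∀ b, γ a ≤ γ b := fun b => ha ⟨b, rfl⟩
  have hbot : ∀ b, γ b = γ a → b = a := fun b hb =>
    h b a (fun c hc => by have := hmin c; omega) (fun c hc => by have := hmin c; omega)
  constructor
  · rw [hl, Finset.card_eq_one]
    refine ⟨a, ?_⟩
    ext b
    simp only [Finset.mem_filter, Finset.mem_univ, true_and, Finset.mem_singleton]
    constructor
    · intro hb
      refine hbot b ?_
      simp only [Fin.val_zero] at hb
      omega
    · rintro rfl
      simp
  · have key : ∀ s : ℕ, s ≤ k → ∃ j, γ j - γ a = ((k - s : ℕ) : ℤ) := by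
      intro s
      induction s with
      | zero => exact fun _ => hk.1
      | succ s ih =>
        intro hs
        obtain ⟨j, hj⟩ := ih (by omega)
        by_contra! hcon
        have hja : j = a := h j a (fun c hc => hcon c (by omega))
          (fun c hc => by have := hmin c; omega)
        subst hja
        omega
    intro t
    obtain ⟨j, hj⟩ := key (k - t) (by omega)
    rw [hl, Finset.card_pos]
    refine ⟨j, ?_⟩
    have := t.2
    simp only [Finset.mem_filter, Finset.mem_univ, true_and]
    omega

theorem card_filter_mod_pos {m n : ℕ} (hm : 0 < m) (hn : 0 < n) {δ : Fin n → ℤ}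
    (h : ∀ a, ∃ c, (m : ℤ) ∣ δ c - (δ a - 1)) (t : Fin m) :
    0 < (Finset.univ.filter fun j => δ j % (m : ℤ) = ((t : ℕ) : ℤ)).card := by
  have key : ∀ s : ℕ, ∃ j, (m : ℤ) ∣ δ j - (δ ⟨0, hn⟩ - s) := by
    intro s
    induction s with
    | zero => exact ⟨⟨0, hn⟩, by simp⟩
    | succ s ih =>
      obtain ⟨j, hj⟩ := ih
      obtain ⟨c, hc⟩ := h j
      refine ⟨c, ?_⟩
      have := dvd_add hj hc
      rwa [show δ j - (δ ⟨0, hn⟩ - s) + (δ c - (δ j - 1)) = δ c - (δ ⟨0, hn⟩ - (s + 1 : ℕ)) by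
        push_cast; ring] at this
  have hm0 : (0 : ℤ) < m := by omega
  obtain ⟨j, hj⟩ := key ((δ ⟨0, hn⟩ - t) % (m : ℤ)).toNat
  rw [Int.toNat_of_nonneg (Int.emod_nonneg _ hm0.ne')] at hj
  rw [Finset.card_pos]
  refine ⟨j, ?_⟩
  simp only [Finset.mem_filter, Finset.mem_univ, true_and]
  have h1 : (m : ℤ) ∣ δ j - t := by
    have h2 := Int.emod_add_mul_ediv (δ ⟨0, hn⟩ - t) m
    have h3 : δ j - t = (δ j - (δ ⟨0, hn⟩ - (δ ⟨0, hn⟩ - t) % (m : ℤ))) +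
        m * ((δ ⟨0, hn⟩ - t) / m) := by linarith
    rw [h3]
    exact dvd_add hj (dvd_mul_right _ _)
  rw [(Int.emod_emod_of_dvd _ dvd_rfl).symm.trans
    (congrArg (· % (m : ℤ)) ((Int.emod_eq_emod_iff_emod_sub_eq_zero).2
      (Int.emod_eq_zero_of_dvd h1)))]
  have := t.2
  rw [Int.emod_emod_of_dvd _ dvd_rfl, Int.emod_eq_of_lt (by omega) (by omega)]

end Representatives

/-! ### Graphs in which every vertex emits at most one edge -/

section Functional

variable (K : Type w) [Field K] {V : Type u} [Quiver.{v} V]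

/-- Two paths with the same source: the shorter one is an initial part of the longer one. -/
theorem exists_eq_comp_of_length_le (hout : ∀ e f : Quiver.Total V, e.left = f.left → e = f)
    {a b c : V} (p : Path a b) (p' : Path a c) (h : p.length ≤ p'.length) :
    ∃ r : Path b c, p' = p.comp r := by
  induction p' generalizing b with
  | nil =>
    have h0 : p.length = 0 := by simpa using h
    obtain rfl := Path.eq_of_length_zero p h0
    obtain rfl := Path.eq_nil_of_length_zero p h0
    exact ⟨Path.nil, rfl⟩
  | @cons c' c p'' e ih =>
    rcases Nat.lt_or_ge p''.length p.length with hlt | hge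
    · cases p with
      | nil => simp at hlt
      | @cons b' _ p₀ e₀ =>
        rw [Path.length_cons, Path.length_cons] at h
        rw [Path.length_cons] at hlt
        obtain ⟨r, hr⟩ := ih p₀ (by omega)
        have hr0 : r.length = 0 := by
          have := congrArg Path.length hr
          rw [Path.length_comp] at this
          omega
        obtain rfl := Path.eq_of_length_zero r hr0
        obtain rfl := Path.eq_nil_of_length_zero r hr0
        have := hout ⟨_, _, e₀⟩ ⟨_, _, e⟩ rfl
        cases this
        exact ⟨Path.nil, by rw [hr]; rfl⟩
    · obtain ⟨r, rfl⟩ := ih p hge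
      exact ⟨r.cons e, rfl⟩

theorem pathElem_mul_ghostElem_self
    (hout : ∀ e f : Quiver.Total V, e.left = f.left → e = f) {a : V} :
    ∀ {b : V} (p : Path a b), pathElem K p * ghostElem K p = lgen K (Gen.vertex a)
  | _, Path.nil => lgen_vertex_mul_self K a
  | _, @Path.cons _ _ _ b' b p e => by
    have h := lgen_edge_mul_ghost_self K (⟨b', b, e⟩ : Quiver.Total V)
      fun f hf => hout _ _ hf
    rw [pathElem, ghostElem, mul_assoc, ← mul_assoc (lgen K _), h, ← mul_assoc,
      pathElem_mul_vertex, pathElem_mul_ghostElem_self hout p]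

/-- A monomial `p q*` depends only on the sources of `p` and `q` and on its degree. -/
theorem monomial_eq_monomial (hout : ∀ e f : Quiver.Total V, e.left = f.left → e = f)
    {a b c c' : V} (p : Path a c) (q : Path b c) (p' : Path a c') (q' : Path b c')
    (h : (p.length : ℤ) - q.length = p'.length - q'.length) :
    pathElem K p * ghostElem K q = pathElem K p' * ghostElem K q' := by
  wlog hle : p.length ≤ p'.length generalizing c c' with H
  · exact (H p' q' p q h.symm (by omega)).symm
  obtain ⟨r, rfl⟩ := exists_eq_comp_of_length_le hout p p' hle
  obtain ⟨r', rfl⟩ := exists_eq_comp_of_length_le hout q q' (by omega)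
  have hlen : r.length = r'.length := by
    rw [Path.length_comp, Path.length_comp] at h
    omega
  obtain ⟨z, hz⟩ := exists_eq_comp_of_length_le hout r r' hlen.le
  have hz0 : z.length = 0 := by
    have := congrArg Path.length hz
    rw [Path.length_comp] at this
    omega
  obtain rfl := Path.eq_nil_of_length_zero z hz0
  obtain rfl : r' = r := hz
  rw [pathElem_comp, ghostElem_comp, mul_assoc, ← mul_assoc (pathElem K r'),
    pathElem_mul_ghostElem_self K hout, ← mul_assoc, pathElem_mul_vertex]

/-- The homomorphism from the Leavitt path algebra to a unital algebra given by elements which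
satisfy the defining relations. -/
noncomputable def lpaLift {A : Type*} [Ring A] [Algebra K A] (g : Gen V → A)
    (hg : ∀ ⦃x y⦄, Rel K V x y → FreeAlgebra.lift K g x = FreeAlgebra.lift K g y) :
    LeavittPathAlgebra K V →ₙₐ[K] A :=
  (RingQuot.liftAlgHom K ⟨FreeAlgebra.lift K g, hg⟩ : UnitalHull K V →ₐ[K] A).toNonUnitalAlgHom.comp
    (NonUnitalSubalgebraClass.subtype (carrier K V))

theorem lpaLift_lgen {A : Type*} [Ring A] [Algebra K A] (g : Gen V → A)
    (hg : ∀ ⦃x y⦄, Rel K V x y → FreeAlgebra.lift K g x = FreeAlgebra.lift K g y) (x : Gen V) :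
    lpaLift K g hg (lgen K x) = g x := by
  change RingQuot.liftAlgHom K ⟨FreeAlgebra.lift K g, hg⟩ (gen K x) = g x
  rw [gen, RingQuot.liftAlgHom_mkAlgHom_apply, FreeAlgebra.lift_ι_apply]

/-- The relations of the Leavitt path algebra, when every vertex emits at most one edge. -/
theorem lift_eq_lift_of_rel (hout : ∀ e f : Quiver.Total V, e.left = f.left → e = f)
    {A : Type*} [Ring A] [Algebra K A] (g : Gen V → A)
    (hne : ∀ x y, x ≠ y → g (Gen.vertex x) * g (Gen.vertex y) = 0)
    (hself : ∀ x, g (Gen.vertex x) * g (Gen.vertex x) = g (Gen.vertex x))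
    (hX : ∀ e : Quiver.Total V, g (Gen.vertex e.left) * g (Gen.edge e) = g (Gen.edge e) ∧
      g (Gen.edge e) * g (Gen.vertex e.right) = g (Gen.edge e))
    (hY : ∀ e : Quiver.Total V, g (Gen.vertex e.right) * g (Gen.ghost e) = g (Gen.ghost e) ∧
      g (Gen.ghost e) * g (Gen.vertex e.left) = g (Gen.ghost e))
    (hYX : ∀ e : Quiver.Total V, g (Gen.ghost e) * g (Gen.edge e) = g (Gen.vertex e.right))
    (hXY : ∀ e : Quiver.Total V, g (Gen.edge e) * g (Gen.ghost e) = g (Gen.vertex e.left))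
    ⦃x y : FreeAlgebra K (Gen V)⦄ (h : Rel K V x y) :
    FreeAlgebra.lift K g x = FreeAlgebra.lift K g y := by
  cases h with
  | v_ne x y h => simpa [fv] using hne x y h
  | v_self x => simpa [fv] using hself x
  | e1_source e => simpa [fv, fe] using (hX e).1
  | e1_range e => simpa [fv, fe] using (hX e).2
  | e2_range e => simpa [fv, fg] using (hY e).1
  | e2_source e => simpa [fv, fg] using (hY e).2
  | ck1_ne e f h =>
    have : g (Gen.ghost e) * g (Gen.edge f) = 0 := by
      rw [← (hY e).2, ← (hX f).1, mul_assoc, ← mul_assoc (g (Gen.vertex e.left)),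
        hne _ _ fun hl => h (hout e f hl), zero_mul, mul_zero]
    simpa [fe, fg] using this
  | ck1_self e => simpa [fv, fe, fg] using hYX e
  | ck2 x S hS hne =>
    obtain ⟨e, he⟩ := hne
    obtain rfl := (hS e).1 he
    have : S = {e} := Finset.eq_singleton_iff_unique_mem.2
      ⟨he, fun f hf => hout _ _ ((hS f).1 hf)⟩
    subst this
    simpa [fv, fe, fg] using (hXY e).symm

/-- A homomorphism which matches the monomials `p q*`, as indexed by the sources of `p` and `q` and
their degree, with a homogeneous basis of a graded algebra is a graded isomorphism. -/
theorem gradedIso_of_monomials (hout : ∀ e f : Quiver.Total V, e.left = f.left → e = f)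
    {A : Type*} [Ring A] [Algebra K A] {𝒜 : ℤ → Submodule K A}
    (φ : LeavittPathAlgebra K V →ₙₐ[K] A) {ι : Type*} (src tgt : ι → V) (deg : ι → ℤ) (β : ι → A)
    (hli : LinearIndependent K β) (hspan : ∀ x, x ∈ Submodule.span K (Set.range β))
    (hmem : ∀ i, β i ∈ 𝒜 (deg i)) (h𝒜 : ∀ d, 𝒜 d ≤ Submodule.span K (β '' {i | deg i = d}))
    (hex : ∀ i, ∃ (c : V) (p : Path (src i) c) (q : Path (tgt i) c),
      (p.length : ℤ) - q.length = deg i)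
    (hidx : ∀ (a b c : V) (p : Path a c) (q : Path b c), ∃ i, src i = a ∧ tgt i = b ∧
      deg i = (p.length : ℤ) - q.length)
    (hφ : ∀ i (c : V) (p : Path (src i) c) (q : Path (tgt i) c),
      (p.length : ℤ) - q.length = deg i → φ (pathElem K p * ghostElem K q) = β i) :
    GradedIso (B := LeavittPathAlgebra K V) 𝒜 (lpaGrading K V) := by
  choose c p q hpq using hex
  set z : ι → LeavittPathAlgebra K V := fun i => pathElem K (p i) * ghostElem K (q i) with hz
  have hφz : ∀ i, φ (z i) = β i := fun i => hφ i _ _ _ (hpq i)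
  have hφz' : ∀ i, (φ : LeavittPathAlgebra K V →ₗ[K] A) (z i) = β i := hφz
  have hmon : ∀ (a b c : V) (p : Path a c) (q : Path b c),
      ∃ i, deg i = (p.length : ℤ) - q.length ∧ pathElem K p * ghostElem K q = z i := by
    intro a b c p q
    obtain ⟨i, rfl, rfl, hi⟩ := hidx a b c p q
    exact ⟨i, hi, monomial_eq_monomial K hout _ _ _ _ (by rw [hpq, hi])⟩
  have hzspan : ∀ x, x ∈ Submodule.span K (Set.range z) := by
    intro x
    refine Submodule.span_mono ?_ (span_monomials K x)
    rintro _ ⟨a, b, c, p, q, rfl⟩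
    obtain ⟨i, _, hi⟩ := hmon a b c p q
    exact ⟨i, hi.symm⟩
  have hinj : Function.Injective φ := by
    rw [injective_iff_map_eq_zero]
    intro x hx
    obtain ⟨f, rfl⟩ := Finsupp.mem_span_range_iff_exists_finsupp.1 (hzspan x)
    have : Finsupp.linearCombination K β f = 0 := by
      rw [← hx, Finsupp.linearCombination_apply]
      simp only [Finsupp.sum, map_sum, map_smul, hφz]
    rw [linearIndependent_iff.1 hli f this, Finsupp.sum_zero_index]
  have hsurj : Function.Surjective φ := by
    intro y
    have hle : Submodule.span K (Set.range β) ≤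
        LinearMap.range (φ : LeavittPathAlgebra K V →ₗ[K] A) := by
      rw [Submodule.span_le]
      rintro _ ⟨i, rfl⟩
      exact ⟨z i, hφz i⟩
    exact hle (hspan y)
  have hfwd : ∀ d x, x ∈ lpaGrading K V d → φ x ∈ 𝒜 d := by
    intro d x hx
    induction hx using Submodule.span_induction with
    | zero => rw [map_zero]; exact zero_mem _
    | add x y _ _ h1 h2 => rw [map_add]; exact add_mem h1 h2
    | smul r x _ h => rw [map_smul]; exact Submodule.smul_mem _ _ h
    | mem x hx =>
      obtain ⟨a, b, c, p, q, hd, rfl⟩ := hx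
      obtain ⟨i, hi, h⟩ := hmon a b c p q
      rw [h, hφz, ← hd, ← hi]
      exact hmem i
  have hbwd : ∀ d x, φ x ∈ 𝒜 d → x ∈ lpaGrading K V d := by
    intro d x hx
    have hle : Submodule.span K (β '' {i | deg i = d}) ≤
        (lpaGrading K V d).map (φ : LeavittPathAlgebra K V →ₗ[K] A) := by
      rw [Submodule.span_le]
      rintro _ ⟨i, hi, rfl⟩
      exact ⟨z i, Submodule.subset_span ⟨_, _, _, p i, q i, (hpq i).trans hi, rfl⟩, hφz i⟩
    obtain ⟨y, hy, hxy⟩ := hle (h𝒜 d hx)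
    rwa [← hinj hxy]
  exact gradedIso_symm ⟨RingEquiv.ofBijective φ ⟨hinj, hsurj⟩,
    fun d x => ⟨hfwd d x, hbwd d x⟩⟩

end Functional

/-! ### A homogeneous basis of a sum of matrix algebras -/

section Basis

variable {K : Type w} [Field K] {k n : ℕ} {I : Fin k → Type} {J : Fin n → Type}
  [∀ i, DecidableEq (I i)] [∀ j, DecidableEq (J j)]

/-- The index set of the basis of matrix units: pairs of indices in the same block and, for a block
over `K[T, T⁻¹]`, an exponent of `T`. -/
abbrev UnitIndex (I : Fin k → Type) (J : Fin n → Type) : Type :=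
  (Σ i, I i × I i) ⊕ (Σ j, J j × J j × ℤ)

variable (K) in
/-- The basis of matrix units. -/
noncomputable def unitBasis : UnitIndex I J → MatrixSum K I J
  | Sum.inl ⟨i, a, b⟩ => unitK K I J i a b
  | Sum.inr ⟨j, a, b, c⟩ => unitL K I J j a b c

/-- The coordinates with respect to the basis of matrix units. -/
def unitCoord : UnitIndex I J → MatrixSum K I J → K
  | Sum.inl ⟨i, a, b⟩, x => x.1 i a b
  | Sum.inr ⟨j, a, b, c⟩, x => (x.2 j a b).coeff c

theorem unitCoord_unitBasis_self (i : UnitIndex I J) : unitCoord i (unitBasis K i) = 1 := by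
  rcases i with ⟨i, a, b⟩ | ⟨j, a, b, c⟩
  · change (unitK K I J i a b).1 i a b = 1
    rw [unitK_fst, Matrix.single_apply_same]
  · change ((unitL K I J j a b c).2 j a b).coeff c = 1
    rw [unitL_snd, Matrix.single_apply_same, LaurentPolynomial.T_apply, if_pos rfl]

theorem unitCoord_unitBasis_ne {i i' : UnitIndex I J} (h : i ≠ i') :
    unitCoord i (unitBasis K i') = 0 := by
  rcases i with ⟨i, a, b⟩ | ⟨j, a, b, c⟩ <;> rcases i' with ⟨i', a', b'⟩ | ⟨j', a', b', c'⟩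
  · change (unitK K I J i' a' b').1 i a b = 0
    by_cases hi : i = i'
    · subst hi
      rw [unitK_fst, Matrix.single_apply, if_neg]
      rintro ⟨rfl, rfl⟩
      exact h rfl
    · have h0 : (unitK K I J i' a' b').1 i = 0 := Pi.single_eq_of_ne hi _
      rw [h0]; rfl
  · rfl
  · rfl
  · change ((unitL K I J j' a' b' c').2 j a b).coeff c = 0
    by_cases hj : j = j'
    · subst hj
      rw [unitL_snd, Matrix.single_apply]
      split_ifs with hab
      · obtain ⟨rfl, rfl⟩ := hab
        rw [LaurentPolynomial.T_apply, if_neg]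
        rintro rfl
        exact h rfl
      · rfl
    · have h0 : (unitL K I J j' a' b' c').2 j = 0 := Pi.single_eq_of_ne hj _
      rw [h0]; rfl

variable (K I J) in
/-- All the coordinates, as a linear map. -/
def unitCoordMap : MatrixSum K I J →ₗ[K] (UnitIndex I J → K) where
  toFun x i := unitCoord i x
  map_add' x y := by
    funext i
    rcases i with ⟨i, a, b⟩ | ⟨j, a, b, c⟩ <;> rfl
  map_smul' r x := by
    funext i
    rcases i with ⟨i, a, b⟩ | ⟨j, a, b, c⟩ <;> rfl

theorem linearIndependent_unitBasis :
    LinearIndependent K (unitBasis K : UnitIndex I J → MatrixSum K I J) := by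
  rw [linearIndependent_iff']
  intro s g hg i hi
  have := congrFun (congrArg (unitCoordMap K I J) hg) i
  rw [map_sum, Finset.sum_apply, Finset.sum_eq_single_of_mem i hi, map_smul, map_zero] at this
  · simpa [unitCoordMap, unitCoord_unitBasis_self] using this
  · intro j _ hj
    rw [map_smul]
    simp [unitCoordMap, unitCoord_unitBasis_ne hj.symm]

theorem mem_span_unitBasis [∀ i, Fintype (I i)] [∀ j, Fintype (J j)] (S : Set (UnitIndex I J))
    (x : MatrixSum K I J) (h : ∀ i, unitCoord i x ≠ 0 → i ∈ S) :
    x ∈ Submodule.span K (unitBasis K '' S) := by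
  have hcoord : ∀ i, unitCoord i x • unitBasis K i ∈ Submodule.span K (unitBasis K '' S) := by
    intro i
    by_cases h0 : unitCoord i x = 0
    · rw [h0, zero_smul]; exact zero_mem _
    · exact Submodule.smul_mem _ _ (Submodule.subset_span ⟨i, h i h0, rfl⟩)
  have h1 : ∀ i, (Pi.single i (x.1 i), 0) ∈ Submodule.span K (unitBasis K '' S) := by
    intro i
    have : (Pi.single i (x.1 i), 0) = ∑ a, ∑ b,
        unitCoord (Sum.inl ⟨i, a, b⟩) x • unitBasis K (Sum.inl ⟨i, a, b⟩ : UnitIndex I J) := by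
      have h2 := congrArg (LinearMap.inl K (∀ i, Matrix (I i) (I i) K)
        (∀ j, Matrix (J j) (J j) K[T;T⁻¹]) ∘ₗ LinearMap.single K _ i)
        (Matrix.matrix_eq_sum_single (x.1 i))
      simp only [map_sum] at h2
      refine h2.trans ?_
      refine Finset.sum_congr rfl fun a _ => Finset.sum_congr rfl fun b _ => ?_
      have h3 : Matrix.single a b (x.1 i a b) = x.1 i a b • Matrix.single a b (1 : K) := by
        rw [Matrix.smul_single, smul_eq_mul, mul_one]
      rw [h3, map_smul]
      rfl
    rw [this]
    exact sum_mem fun a _ => sum_mem fun b _ => hcoord _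
  have h2 : ∀ j, (0, Pi.single j (x.2 j)) ∈ Submodule.span K (unitBasis K '' S) := by
    intro j
    have : (0, Pi.single j (x.2 j)) = ∑ a, ∑ b, ∑ c ∈ (x.2 j a b).coeff.support,
        unitCoord (Sum.inr ⟨j, a, b, c⟩) x •
          unitBasis K (Sum.inr ⟨j, a, b, c⟩ : UnitIndex I J) := by
      have h2 := congrArg (LinearMap.inr K (∀ i, Matrix (I i) (I i) K)
        (∀ j, Matrix (J j) (J j) K[T;T⁻¹]) ∘ₗ LinearMap.single K _ j)
        (Matrix.matrix_eq_sum_single (x.2 j))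
      simp only [map_sum] at h2
      refine h2.trans ?_
      refine Finset.sum_congr rfl fun a _ => Finset.sum_congr rfl fun b _ => ?_
      have h3 : x.2 j a b = ∑ c ∈ (x.2 j a b).coeff.support,
          (x.2 j a b).coeff c • (LaurentPolynomial.T c : K[T;T⁻¹]) := by
        refine (AddMonoidAlgebra.sum_coeff_single _).symm.trans (Finset.sum_congr rfl fun c _ => ?_)
        rw [LaurentPolynomial.T, AddMonoidAlgebra.smul_single, smul_eq_mul, mul_one]
      have h4 : Matrix.single a b (x.2 j a b) = ∑ c ∈ (x.2 j a b).coeff.support,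
          (x.2 j a b).coeff c • Matrix.single a b (LaurentPolynomial.T c : K[T;T⁻¹]) := by
        have h5 := congrArg (Matrix.singleLinearMap K a b) h3
        simp only [map_sum, map_smul] at h5
        exact h5
      rw [h4, map_sum]
      refine Finset.sum_congr rfl fun c _ => ?_
      rw [map_smul]
      rfl
    rw [this]
    exact sum_mem fun a _ => sum_mem fun b _ => sum_mem fun c _ => hcoord _
  have hx : x = ∑ i, (Pi.single i (x.1 i), 0) + ∑ j, (0, Pi.single j (x.2 j)) := by
    refine Prod.ext ?_ ?_
    · rw [Prod.fst_add, Prod.fst_sum, Prod.fst_sum, Finset.sum_const_zero, add_zero]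
      exact (Finset.univ_sum_single x.1).symm
    · rw [Prod.snd_add, Prod.snd_sum, Prod.snd_sum, Finset.sum_const_zero, zero_add]
      exact (Finset.univ_sum_single x.2).symm
  rw [hx]
  exact add_mem (sum_mem fun i _ => h1 i) (sum_mem fun j _ => h2 j)

end Basis

/-! ### The graph of a successor function -/

section StepGraph

variable {k n : ℕ} {I : Fin k → Type} {J : Fin n → Type}

/-- The vertices of the graph of a partial successor function `nK` on the indices of the blocks over
`K`, and of a successor function `nL` on the indices of the blocks over `K[T, T⁻¹]`. -/
structure StepVertex (nK : ∀ i, I i → Option (I i)) (nL : ∀ j, J j → J j) : Type u where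
  /-- The index of the vertex. -/
  val : (Σ i, I i) ⊕ Σ j, J j

variable (nK : ∀ i, I i → Option (I i)) (nL : ∀ j, J j → J j)

/-- The relation between an index and its successor. -/
inductive Step : (Σ i, I i) ⊕ (Σ j, J j) → (Σ i, I i) ⊕ (Σ j, J j) → Prop
  | blockK (i : Fin k) (a a' : I i) (h : nK i a = some a') :
      Step (Sum.inl ⟨i, a⟩) (Sum.inl ⟨i, a'⟩)
  | blockL (j : Fin n) (a : J j) : Step (Sum.inr ⟨j, a⟩) (Sum.inr ⟨j, nL j a⟩)

instance : Quiver.{v} (StepVertex.{u} nK nL) :=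
  ⟨fun x y => ULift.{v} (PLift (Step nK nL x.val y.val))⟩

variable {nK nL}

theorem Step.right_unique {x y z : (Σ i, I i) ⊕ (Σ j, J j)} (h : Step nK nL x y)
    (h' : Step nK nL x z) : y = z := by
  cases h with
  | blockK i a a' h =>
    cases h' with
    | blockK _ _ a'' h' =>
      rw [h, Option.some_inj] at h'
      rw [h']
  | blockL j a =>
    cases h'
    rfl

/-- The edge of the graph given by a successor. -/
def Step.hom {x y : (Σ i, I i) ⊕ (Σ j, J j)} (h : Step nK nL x y) :
    (⟨x⟩ : StepVertex.{u} nK nL) ⟶ (⟨y⟩ : StepVertex.{u} nK nL) :=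
  (ULift.up (PLift.up h) : ULift.{v} (PLift (Step nK nL x y)))

theorem step_of_edge (e : Quiver.Total.{v, u} (StepVertex.{u} nK nL)) :
    Step nK nL e.left.val e.right.val :=
  e.hom.down.down

theorem stepGraph_out (e f : Quiver.Total.{v, u} (StepVertex.{u} nK nL)) (h : e.left = f.left) :
    e = f := by
  obtain ⟨⟨x⟩, ⟨y⟩, ⟨⟨he⟩⟩⟩ := e
  obtain ⟨⟨x'⟩, ⟨y'⟩, ⟨⟨hf⟩⟩⟩ := f
  cases h
  have := he.right_unique hf
  change y = y' at this
  subst this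
  rfl

theorem finiteGraph_stepGraph [∀ i, Finite (I i)] [∀ j, Finite (J j)] :
    FiniteGraph.{u, v} (StepVertex.{u} nK nL) := by
  have h : Finite (StepVertex.{u} nK nL) :=
    Finite.of_injective StepVertex.val fun ⟨x⟩ ⟨y⟩ h => by
      change x = y at h
      rw [h]
  exact ⟨h, Finite.of_injective Total.left stepGraph_out⟩

theorem noExit_of_out {V : Type u} [Quiver.{v} V]
    (hout : ∀ e f : Quiver.Total V, e.left = f.left → e = f) : NoExit V := by
  intro a c _ x hx
  obtain ⟨e, _, rfl⟩ := List.mem_map.1 hx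
  exact ⟨e, rfl, fun f hf => hout f e hf⟩

end StepGraph

section StepIso

variable {K : Type w} [Field K] {k n : ℕ} {I : Fin k → Type} {J : Fin n → Type}
  [∀ i, Fintype (I i)] [∀ j, Fintype (J j)] [∀ i, DecidableEq (I i)] [∀ j, DecidableEq (J j)]

theorem unitK_mul_unitK (i : Fin k) (a b c : I i) :
    unitK K I J i a b * unitK K I J i b c = unitK K I J i a c := by
  refine Prod.ext ?_ (mul_zero 0)
  change Pi.single i _ * Pi.single i _ = Pi.single i _
  rw [← Pi.single_mul, Matrix.single_mul_single_same, mul_one]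

theorem unitL_mul_unitL (j : Fin n) (a b c : J j) (p q : ℤ) :
    unitL K I J j a b p * unitL K I J j b c q = unitL K I J j a c (p + q) := by
  refine Prod.ext (mul_zero 0) ?_
  change Pi.single j _ * Pi.single j _ = Pi.single j _
  rw [← Pi.single_mul, Matrix.single_mul_single_same, LaurentPolynomial.T_add]

theorem pi_single_mul_single_of_ne {ι : Type*} [DecidableEq ι] {R : ι → Type*}
    [∀ i, NonUnitalNonAssocSemiring (R i)] {i i' : ι} (h : i ≠ i') (x : R i) (y : R i') :
    Pi.single i x * Pi.single i' y = 0 := by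
  funext r
  rw [Pi.mul_apply]
  by_cases hr : r = i
  · rw [Pi.single_eq_of_ne (M := R) (i := i') (by rw [hr]; exact h), mul_zero]
    rfl
  · rw [Pi.single_eq_of_ne (M := R) hr, zero_mul]
    rfl

variable (K) in
/-- The diagonal matrix unit of an index. -/
noncomputable def diagUnit : (Σ i, I i) ⊕ (Σ j, J j) → MatrixSum K I J
  | Sum.inl ⟨i, a⟩ => unitK K I J i a a
  | Sum.inr ⟨j, a⟩ => unitL K I J j a a 0

theorem diagUnit_mul_self (x : (Σ i, I i) ⊕ (Σ j, J j)) :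
    diagUnit K x * diagUnit K x = diagUnit K x := by
  rcases x with ⟨i, a⟩ | ⟨j, a⟩
  · exact unitK_mul_unitK i a a a
  · exact (unitL_mul_unitL j a a a 0 0).trans (by rw [add_zero]; rfl)

theorem diagUnit_mul_ne {x y : (Σ i, I i) ⊕ (Σ j, J j)} (h : x ≠ y) :
    diagUnit K x * diagUnit K y = 0 := by
  rcases x with ⟨i, a⟩ | ⟨j, a⟩ <;> rcases y with ⟨i', a'⟩ | ⟨j', a'⟩
  · refine Prod.ext ?_ (mul_zero 0)
    change (Pi.single i (Matrix.single a a 1) : ∀ i, Matrix (I i) (I i) K) *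
      (Pi.single i' (Matrix.single a' a' 1) : ∀ i, Matrix (I i) (I i) K) = 0
    by_cases hi : i = i'
    · subst hi
      rw [← Pi.single_mul, Matrix.single_mul_single_of_ne, Pi.single_zero]
      rintro rfl
      exact h rfl
    · exact pi_single_mul_single_of_ne hi _ _
  · exact Prod.ext (mul_zero _) (zero_mul _)
  · exact Prod.ext (zero_mul _) (mul_zero _)
  · refine Prod.ext (mul_zero 0) ?_
    change (Pi.single j (Matrix.single a a (LaurentPolynomial.T 0)) :
        ∀ j, Matrix (J j) (J j) K[T;T⁻¹]) *
      (Pi.single j' (Matrix.single a' a' (LaurentPolynomial.T 0)) :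
        ∀ j, Matrix (J j) (J j) K[T;T⁻¹]) = 0
    by_cases hj : j = j'
    · subst hj
      rw [← Pi.single_mul, Matrix.single_mul_single_of_ne, Pi.single_zero]
      rintro rfl
      exact h rfl
    · exact pi_single_mul_single_of_ne hj _ _

variable (nK : ∀ i, I i → Option (I i)) (nL : ∀ j, J j → J j) (cL : ∀ j, J j → ℤ)

variable (K) in
/-- The images of the edges, which depend only on the source: the matrix unit from an index to its
successor, with a power of `T` prescribed by `cL`. -/
noncomputable def edgeUnit : (Σ i, I i) ⊕ (Σ j, J j) → MatrixSum K I J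
  | Sum.inl ⟨i, a⟩ => unitK K I J i a ((nK i a).getD a)
  | Sum.inr ⟨j, a⟩ => unitL K I J j a (nL j a) (cL j a)

variable (K) in
/-- The images of the ghost edges. -/
noncomputable def ghostUnit : (Σ i, I i) ⊕ (Σ j, J j) → MatrixSum K I J
  | Sum.inl ⟨i, a⟩ => unitK K I J i ((nK i a).getD a) a
  | Sum.inr ⟨j, a⟩ => unitL K I J j (nL j a) a (-cL j a)

variable (K) in
/-- The images of the generators. -/
noncomputable def genUnit : Gen.{u, v} (StepVertex.{u} nK nL) → MatrixSum K I J
  | Gen.vertex x => diagUnit K x.val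
  | Gen.edge e => edgeUnit K nK nL cL e.left.val
  | Gen.ghost e => ghostUnit K nK nL cL e.left.val

variable {nK nL}

theorem edgeUnit_relations {x y : (Σ i, I i) ⊕ (Σ j, J j)} (h : Step nK nL x y) :
    (diagUnit K x * edgeUnit K nK nL cL x = edgeUnit K nK nL cL x ∧
      edgeUnit K nK nL cL x * diagUnit K y = edgeUnit K nK nL cL x) ∧
    (diagUnit K y * ghostUnit K nK nL cL x = ghostUnit K nK nL cL x ∧
      ghostUnit K nK nL cL x * diagUnit K x = ghostUnit K nK nL cL x) ∧
    ghostUnit K nK nL cL x * edgeUnit K nK nL cL x = diagUnit K y ∧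
    edgeUnit K nK nL cL x * ghostUnit K nK nL cL x = diagUnit K x := by
  cases h with
  | blockK i a a' h =>
    simp only [diagUnit, edgeUnit, ghostUnit, h, Option.getD_some, unitK_mul_unitK, and_self]
  | blockL j a =>
    simp only [diagUnit, edgeUnit, ghostUnit, unitL_mul_unitL, zero_add, add_zero,
      neg_add_cancel, add_neg_cancel, and_self]

variable (K) in
/-- The homomorphism from the Leavitt path algebra of the graph of a successor function. -/
noncomputable def stepHom :
    LeavittPathAlgebra.{u, v} K (StepVertex.{u} nK nL) →ₙₐ[K] MatrixSum K I J :=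
  lpaLift K (genUnit K nK nL cL) <| by
    refine lift_eq_lift_of_rel K stepGraph_out _ (fun x y h => diagUnit_mul_ne ?_)
      (fun x => diagUnit_mul_self _)
      (fun e => (edgeUnit_relations cL (step_of_edge e)).1)
      (fun e => (edgeUnit_relations cL (step_of_edge e)).2.1)
      (fun e => (edgeUnit_relations cL (step_of_edge e)).2.2.1)
      (fun e => (edgeUnit_relations cL (step_of_edge e)).2.2.2)
    rintro h'
    obtain ⟨x⟩ := x
    obtain ⟨y⟩ := y
    exact h (congrArg StepVertex.mk h')

theorem stepHom_lgen (x : Gen.{u, v} (StepVertex.{u} nK nL)) :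
    stepHom K cL (lgen K x) = genUnit K nK nL cL x :=
  lpaLift_lgen K _ _ x

variable {γ : ∀ i, I i → ℤ} {m : Fin n → ℕ} {δ : ∀ j, J j → ℤ}

theorem stepHom_path_blockK (hK : ∀ i a a', nK i a = some a' → γ i a - γ i a' = 1)
    {i : Fin k} {a : I i} {y : StepVertex.{u} nK nL}
    (p : Quiver.Path.{v, u} (⟨Sum.inl ⟨i, a⟩⟩ : StepVertex.{u} nK nL) y) :
    ∃ a', y = ⟨Sum.inl ⟨i, a'⟩⟩ ∧ γ i a - γ i a' = p.length ∧
      stepHom K cL (pathElem K p) = unitK K I J i a a' ∧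
      stepHom K cL (ghostElem K p) = unitK K I J i a' a := by
  induction p with
  | nil => exact ⟨a, rfl, by simp, stepHom_lgen cL _, stepHom_lgen cL _⟩
  | @cons y z p e ih =>
    obtain ⟨a', rfl, hγ, h1, h2⟩ := ih
    obtain ⟨z⟩ := z
    have hs : Step nK nL (Sum.inl ⟨i, a'⟩) z := e.down.down
    cases hs with
    | blockK _ _ a'' h =>
      refine ⟨a'', rfl, ?_, ?_, ?_⟩
      · rw [Path.length_cons]
        have := hK i a' a'' h
        push_cast
        omega
      · rw [pathElem, map_mul, h1, stepHom_lgen]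
        change _ * unitK K I J i a' ((nK i a').getD a') = _
        rw [h, Option.getD_some, unitK_mul_unitK]
      · rw [ghostElem, map_mul, h2, stepHom_lgen]
        change unitK K I J i ((nK i a').getD a') a' * _ = _
        rw [h, Option.getD_some, unitK_mul_unitK]

theorem stepHom_path_blockL (hL : ∀ j a, (m j : ℤ) * cL j a = 1 - δ j a + δ j (nL j a))
    {j : Fin n} {a : J j} {y : StepVertex.{u} nK nL}
    (p : Quiver.Path.{v, u} (⟨Sum.inr ⟨j, a⟩⟩ : StepVertex.{u} nK nL) y) :
    ∃ (a' : J j) (c : ℤ), y = ⟨Sum.inr ⟨j, a'⟩⟩ ∧ (m j : ℤ) * c = p.length - δ j a + δ j a' ∧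
      stepHom K cL (pathElem K p) = unitL K I J j a a' c ∧
      stepHom K cL (ghostElem K p) = unitL K I J j a' a (-c) := by
  induction p with
  | nil =>
    exact ⟨a, 0, rfl, by simp, stepHom_lgen cL _,
      by rw [neg_zero]; exact stepHom_lgen cL _⟩
  | @cons y z p e ih =>
    obtain ⟨a', c, rfl, hδ, h1, h2⟩ := ih
    obtain ⟨z⟩ := z
    have hs : Step nK nL (Sum.inr ⟨j, a'⟩) z := e.down.down
    cases hs with
    | blockL _ _ =>
      refine ⟨nL j a', c + cL j a', rfl, ?_, ?_, ?_⟩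
      · rw [Path.length_cons, mul_add, hδ, hL]
        push_cast
        ring
      · rw [pathElem, map_mul, h1, stepHom_lgen]
        change _ * unitL K I J j a' (nL j a') (cL j a') = _
        rw [unitL_mul_unitL]
      · rw [ghostElem, map_mul, h2, stepHom_lgen]
        change unitL K I J j (nL j a') a' (-cL j a') * _ = _
        rw [unitL_mul_unitL, neg_add_rev]

/-- The Leavitt path algebra of the graph of a successor function is graded isomorphic to the sum of
matrix algebras on the same indices, if the successor lowers the shifts by one (modulo `m j` in a
block over `K[T, T⁻¹]`), and if there are enough paths to reach all the matrix units. -/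
theorem gradedIso_stepGraph (hm : ∀ j, 0 < m j)
    (hK : ∀ i a a', nK i a = some a' → γ i a - γ i a' = 1)
    (hL : ∀ j a, (m j : ℤ) * cL j a = 1 - δ j a + δ j (nL j a))
    (hexK : ∀ i (a b : I i), ∃ y, Nonempty
        (Quiver.Path.{v, u} (⟨Sum.inl ⟨i, a⟩⟩ : StepVertex.{u} nK nL) y) ∧
      Nonempty (Quiver.Path.{v, u} (⟨Sum.inl ⟨i, b⟩⟩ : StepVertex.{u} nK nL) y))
    (hexL : ∀ j (a b : J j) (c : ℤ),
      ∃ (y : _) (p : Quiver.Path.{v, u} (⟨Sum.inr ⟨j, a⟩⟩ : StepVertex.{u} nK nL) y)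
        (q : Quiver.Path.{v, u} (⟨Sum.inr ⟨j, b⟩⟩ : StepVertex.{u} nK nL) y),
        (p.length : ℤ) - q.length = δ j a - δ j b + m j * c) :
    GradedIso (B := LeavittPathAlgebra.{u, v} K (StepVertex.{u} nK nL))
      (matrixSumGrading K γ m δ) (lpaGrading K (StepVertex.{u} nK nL)) := by
  have hm0 : ∀ j, (m j : ℤ) ≠ 0 := fun j => by have := hm j; omega
  let src : UnitIndex I J → StepVertex.{u} nK nL
    | Sum.inl ⟨i, a, b⟩ => ⟨Sum.inl ⟨i, a⟩⟩
    | Sum.inr ⟨j, a, b, c⟩ => ⟨Sum.inr ⟨j, a⟩⟩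
  let tgt : UnitIndex I J → StepVertex.{u} nK nL
    | Sum.inl ⟨i, a, b⟩ => ⟨Sum.inl ⟨i, b⟩⟩
    | Sum.inr ⟨j, a, b, c⟩ => ⟨Sum.inr ⟨j, b⟩⟩
  let deg : UnitIndex I J → ℤ
    | Sum.inl ⟨i, a, b⟩ => γ i a - γ i b
    | Sum.inr ⟨j, a, b, c⟩ => δ j a - δ j b + m j * c
  refine gradedIso_of_monomials K stepGraph_out (stepHom K cL) src tgt deg (unitBasis K)
    linearIndependent_unitBasis ?_ ?_ ?_ ?_ ?_ ?_
  · intro x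
    rw [← Set.image_univ]
    exact mem_span_unitBasis Set.univ x fun _ _ => trivial
  · rintro (⟨i, a, b⟩ | ⟨j, a, b, c⟩)
    · exact unitK_mem rfl
    · exact unitL_mem rfl
  · intro d x hx
    refine mem_span_unitBasis _ x ?_
    rintro (⟨i, a, b⟩ | ⟨j, a, b, c⟩) h0
    · by_contra hne
      exact h0 (fst_apply_eq_zero hx hne)
    · have := mem_laurentGrading_iff.1 (hx.2 j a b) c h0
      change δ j a - δ j b + m j * c = d
      rw [this]
      ring
  · rintro (⟨i, a, b⟩ | ⟨j, a, b, c⟩)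
    · obtain ⟨y, ⟨p⟩, ⟨q⟩⟩ := hexK i a b
      refine ⟨y, p, q, ?_⟩
      obtain ⟨a', rfl, h1, -⟩ := stepHom_path_blockK (K := K) cL hK p
      obtain ⟨b', hb, h2, -⟩ := stepHom_path_blockK (K := K) cL hK q
      cases hb
      change _ = γ i a - γ i b
      omega
    · exact hexL j a b c
  · rintro ⟨⟨i, a⟩ | ⟨j, a⟩⟩ ⟨⟨i', b⟩ | ⟨j', b⟩⟩ y p q
    · obtain ⟨a', rfl, h1, -⟩ := stepHom_path_blockK (K := K) cL hK p
      obtain ⟨b', hb, h2, -⟩ := stepHom_path_blockK (K := K) cL hK q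
      cases hb
      refine ⟨Sum.inl ⟨i, a, b⟩, rfl, rfl, ?_⟩
      change γ i a - γ i b = _
      omega
    · obtain ⟨a', rfl, h1, -⟩ := stepHom_path_blockK (K := K) cL hK p
      obtain ⟨b', c', hb, h2, -⟩ := stepHom_path_blockL (K := K) cL hL q
      cases hb
    · obtain ⟨a', c, rfl, h1, -⟩ := stepHom_path_blockL (K := K) cL hL p
      obtain ⟨b', hb, h2, -⟩ := stepHom_path_blockK (K := K) cL hK q
      cases hb
    · obtain ⟨a', c, rfl, h1, -⟩ := stepHom_path_blockL (K := K) cL hL p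
      obtain ⟨b', c', hb, h2, -⟩ := stepHom_path_blockL (K := K) cL hL q
      cases hb
      refine ⟨Sum.inr ⟨j, a, b, c - c'⟩, rfl, rfl, ?_⟩
      change δ j a - δ j b + m j * (c - c') = _
      rw [mul_sub, h1, h2]
      ring
  · rintro (⟨i, a, b⟩ | ⟨j, a, b, c⟩) y p q h
    · obtain ⟨a', rfl, -, h1, -⟩ := stepHom_path_blockK (K := K) cL hK p
      obtain ⟨b', hb, -, -, h2⟩ := stepHom_path_blockK (K := K) cL hK q
      cases hb
      rw [map_mul, h1, h2, unitK_mul_unitK]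
      rfl
    · obtain ⟨a', c₁, rfl, hc₁, h1, -⟩ := stepHom_path_blockL (K := K) cL hL p
      obtain ⟨b', c₂, hb, hc₂, -, h2⟩ := stepHom_path_blockL (K := K) cL hL q
      cases hb
      rw [map_mul, h1, h2, unitL_mul_unitL]
      have hc : c₁ + -c₂ = c := by
        refine mul_left_cancel₀ (hm0 j) ?_
        rw [mul_add, mul_neg, hc₁, hc₂]
        have h : (p.length : ℤ) - q.length = δ j a - δ j b + m j * c := h
        linarith
      rw [hc]
      rfl

end StepIso

/-! ### Graphs for lists of shifts without gaps -/

section BlockGraph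

/-- The successor of an index at level `t > 0` is the first index at level `t - 1`. -/
def predBlock {r : ℕ} {l : Fin r → ℕ} (hl : ∀ t, 0 < l t) (a : Blocks l) : Option (Blocks l) :=
  if a.1.val = 0 then none
  else some ⟨⟨a.1.val - 1, (Nat.sub_le _ _).trans_lt a.1.2⟩, ⟨0, hl _⟩⟩

theorem blockShifts_predBlock {r : ℕ} {l : Fin r → ℕ} (hl : ∀ t, 0 < l t) (a a' : Blocks l)
    (h : predBlock hl a = some a') : blockShifts l a - blockShifts l a' = 1 := by
  unfold predBlock at h
  split_ifs at h with h0
  rw [Option.some_inj] at h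
  subst h
  simp only [blockShifts]
  omega

/-- The residue of an integer modulo `m`. -/
def residue {m : ℕ} (hm : 0 < m) (z : ℤ) : Fin m :=
  ⟨(z % (m : ℤ)).toNat, by have := Int.emod_lt_of_pos z (show (0 : ℤ) < m by omega); omega⟩

theorem val_residue {m : ℕ} (hm : 0 < m) (z : ℤ) : ((residue hm z : ℕ) : ℤ) = z % (m : ℤ) :=
  Int.toNat_of_nonneg (Int.emod_nonneg _ (by omega))

/-- The first index at the level of the residue of `z` modulo `m`. -/
def residueBlock {m : ℕ} (hm : 0 < m) {s : Fin m → ℕ} (hs : ∀ t, 0 < s t) (z : ℤ) : Blocks s :=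
  ⟨residue hm z, ⟨0, hs _⟩⟩

theorem residueBlock_congr {m : ℕ} (hm : 0 < m) {s : Fin m → ℕ} (hs : ∀ t, 0 < s t) {z z' : ℤ}
    (h : z % (m : ℤ) = z' % (m : ℤ)) : residueBlock hm hs z = residueBlock hm hs z' := by
  have hr : residue hm z = residue hm z' := by
    apply Fin.ext
    have := val_residue hm z
    have := val_residue hm z'
    omega
  exact congrArg (fun t => (⟨t, ⟨0, hs t⟩⟩ : Blocks s)) hr

theorem blockShifts_residueBlock {m : ℕ} (hm : 0 < m) {s : Fin m → ℕ} (hs : ∀ t, 0 < s t)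
    (z : ℤ) : blockShifts s (residueBlock hm hs z) = z % (m : ℤ) :=
  val_residue hm z

variable {k n : ℕ} {k' : Fin k → ℕ} {l : ∀ i, Fin (k' i + 1) → ℕ} {m : Fin n → ℕ}
  {s : ∀ j, Fin (m j) → ℕ}

variable (hl : ∀ i t, 0 < l i t) (hm : ∀ j, 0 < m j) (hs : ∀ j t, 0 < s j t)

/-- The successor of an index at level `t` in a block over `K[x^m, x^{-m}]` is the first index at
level `t - 1` modulo `m`. -/
abbrev predResidueBlock (j : Fin n) (a : Blocks (s j)) : Blocks (s j) :=
  residueBlock (hm j) (hs j) (blockShifts (s j) a - 1)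

/-- The graph for a list of shifts without gaps. In a block over `K` it is a tree in which every
index at level `t > 0` emits one edge, to the first index at level `t - 1`. In a block over
`K[x^m, x^{-m}]` every index at level `t` emits one edge, to the first index at level `t - 1`
modulo `m`, so that the first indices form a cycle of length `m`. -/
abbrev BlockGraph : Type u :=
  StepVertex.{u} (fun i => predBlock (hl i)) (predResidueBlock hm hs)

theorem exists_path_to_bottom (i : Fin k) (t : ℕ) (a : Blocks (l i)) (ha : a.1.val = t) :
    ∃ b : Blocks (l i), b.1.val = 0 ∧
      Nonempty (Quiver.Path.{v, u} (⟨Sum.inl ⟨i, a⟩⟩ : BlockGraph.{u} hl hm hs)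
        ⟨Sum.inl ⟨i, b⟩⟩) := by
  induction t generalizing a with
  | zero => exact ⟨a, ha, ⟨Path.nil⟩⟩
  | succ t ih =>
    obtain ⟨a', ha', hlev⟩ : ∃ a', predBlock (hl i) a = some a' ∧ a'.1.val = t := by
      refine ⟨_, if_neg (by omega), ?_⟩
      change a.1.val - 1 = t
      omega
    obtain ⟨b, hb, ⟨p⟩⟩ := ih a' hlev
    exact ⟨b, hb, ⟨(Step.blockK (nK := fun i => predBlock (hl i))
      (nL := predResidueBlock hm hs) i a a' ha').hom.toPath.comp p⟩⟩

theorem exists_path_of_length (j : Fin n) (a : Blocks (s j)) (N : ℕ) :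
    ∀ z, z = residueBlock (hm j) (hs j) (blockShifts (s j) a - (N + 1 : ℕ)) →
      ∃ p : Quiver.Path.{v, u} (⟨Sum.inr ⟨j, a⟩⟩ : BlockGraph.{u} hl hm hs) ⟨Sum.inr ⟨j, z⟩⟩,
        p.length = N + 1 := by
  have hstep := fun b => (Step.blockL (nK := fun i => predBlock (hl i))
    (nL := predResidueBlock hm hs) j b).hom
  induction N with
  | zero =>
    rintro _ rfl
    exact ⟨(hstep a).toPath, rfl⟩
  | succ N ih =>
    rintro z rfl
    obtain ⟨p, hp⟩ := ih _ rfl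
    have h : residueBlock (hm j) (hs j) (blockShifts (s j) a - (N + 1 + 1 : ℕ)) =
        residueBlock (hm j) (hs j) (blockShifts (s j)
          (residueBlock (hm j) (hs j) (blockShifts (s j) a - (N + 1 : ℕ))) - 1) := by
      apply residueBlock_congr
      rw [blockShifts_residueBlock, Int.emod_sub_emod]
      congr 1
      push_cast
      ring
    rw [h]
    exact ⟨p.cons (hstep _), by rw [Path.length_cons, hp]⟩

theorem gradedIso_blockGraph {K : Type w} [Field K] (hl0 : ∀ i, l i 0 = 1) :
    GradedIso (B := LeavittPathAlgebra.{u, v} K (BlockGraph.{u} hl hm hs))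
      (matrixSumGrading K (fun i => blockShifts (l i)) m (fun j => blockShifts (s j)))
      (lpaGrading K (BlockGraph.{u} hl hm hs)) := by
  refine gradedIso_stepGraph
    (fun j a => (1 - blockShifts (s j) a +
      blockShifts (s j) (residueBlock (hm j) (hs j) (blockShifts (s j) a - 1))) / (m j : ℤ))
    hm (fun i a a' h => blockShifts_predBlock (hl i) a a' h) ?_ ?_ ?_
  · intro j a
    refine Int.mul_ediv_cancel' ?_
    rw [blockShifts_residueBlock]
    have := Int.emod_add_mul_ediv (blockShifts (s j) a - 1) (m j)
    exact ⟨-((blockShifts (s j) a - 1) / (m j : ℤ)), by linarith⟩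
  · intro i a b
    obtain ⟨⟨t, x⟩, ha, hp⟩ := exists_path_to_bottom.{u, v} hl hm hs i _ a rfl
    obtain ⟨⟨t', x'⟩, hb, hq⟩ := exists_path_to_bottom.{u, v} hl hm hs i _ b rfl
    obtain rfl : t = 0 := Fin.ext ha
    obtain rfl : t' = 0 := Fin.ext hb
    have := hl0 i
    obtain rfl : x = x' := Fin.ext (by omega)
    exact ⟨_, hp, hq⟩
  · intro j a b c
    -- Two walks whose lengths differ by `d` end at the same vertex, once both are nontrivial.
    set d := blockShifts (s j) a - blockShifts (s j) b + m j * c with hd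
    obtain ⟨p, hp⟩ := exists_path_of_length.{u, v} hl hm hs j a d.toNat _ rfl
    obtain ⟨q, hq⟩ := exists_path_of_length.{u, v} hl hm hs j b (-d).toNat
      (residueBlock (hm j) (hs j) (blockShifts (s j) a - (d.toNat + 1 : ℕ))) (by
        apply residueBlock_congr
        have : blockShifts (s j) b - ((-d).toNat + 1 : ℕ) =
            blockShifts (s j) a - (d.toNat + 1 : ℕ) + m j * c := by
          push_cast
          omega
        rw [this, Int.add_mul_emod_self_left])
    refine ⟨_, p, q, ?_⟩
    rw [hp, hq]
    push_cast
    omega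

end BlockGraph

end LPA

theorem proposition3p6 {K : Type w} [Field K] (k n : ℕ)
    (sizeK : Fin k → ℕ) (sizeL : Fin n → ℕ) (m : Fin n → ℕ)
    (hK : ∀ i, 0 < sizeK i) (hL : ∀ j, 0 < sizeL j) (hm : ∀ j, 0 < m j)
    (γ : ∀ i, Fin (sizeK i) → ℤ) (δ : ∀ j, Fin (sizeL j) → ℤ) :
    List.TFAE [
      ∃ (V : Type u) (_ : Quiver.{v} V),
        LPA.GradedIso (LPA.matrixSumGrading K γ m δ) (LPA.lpaGrading K V),
      ∃ (V : Type u) (_ : Quiver.{v} V), LPA.FiniteGraph V ∧ LPA.NoExit V ∧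
        LPA.GradedIso (LPA.matrixSumGrading K γ m δ) (LPA.lpaGrading K V),
      ∃ (k' : Fin k → ℕ) (l : ∀ i, Fin (k' i + 1) → ℕ) (s : ∀ j, Fin (m j) → ℕ),
        (∀ i, l i 0 = 1) ∧ (∀ i t, 0 < l i t) ∧ (∀ j t, 0 < s j t) ∧
        (∀ i, sizeK i = ∑ t, l i t) ∧ (∀ j, sizeL j = ∑ t, s j t) ∧
        LPA.GradedIso (LPA.matrixSumGrading K γ m δ)
          (LPA.matrixSumGrading K (fun i => LPA.blockShifts (l i)) m
            (fun j => LPA.blockShifts (s j))),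
      ∀ (k' : Fin k → ℕ) (l : ∀ i, Fin (k' i + 1) → ℕ) (s : ∀ j, Fin (m j) → ℕ),
        (∀ i, LPA.IsRepresentatives K (γ i) (k' i) (l i)) →
        (∀ j, LPA.IsLaurentRepresentatives K (m j) (δ j) (s j)) →
        (∀ i, l i 0 = 1 ∧ ∀ t, 0 < l i t) ∧ (∀ j t, 0 < s j t)] := by
  tfae_have 2 → 1 := fun ⟨V, q, _, _, h⟩ => ⟨V, q, h⟩
  tfae_have 1 → 4 := by
    rintro ⟨V, q, h⟩ k' l s hl hs
    choose γ' hγ' c hc hk' hcard using hl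
    choose δ' hδ' hcard' using hs
    -- The representatives are read off from shifts `γ'`, `δ'` to which the isomorphism with the
    -- Leavitt path algebra can be transported.
    have h' := LPA.gradedIso_trans (LPA.gradedIso_symm (LPA.gradedIso_matrixSum hγ' hδ')) h
    refine ⟨fun i => LPA.card_filter_of_no_gap (LPA.eq_of_no_predecessor hm h' i) (hc i) (hk' i)
      (l i) (hcard i), fun j t => ?_⟩
    rw [hcard']
    exact LPA.card_filter_mod_pos (hm j) (hL j) (LPA.exists_predecessor_mod hm h' j) t
  tfae_have 4 → 3 := by
    intro h
    choose k' l hl hsum hiso using fun i => LPA.exists_isRepresentatives (K := K) (hK i) (γ i)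
    choose s hs hsum' hiso' using
      fun j => LPA.exists_isLaurentRepresentatives (K := K) (hm j) (δ j)
    obtain ⟨h1, h2⟩ := h k' l s hl hs
    exact ⟨k', l, s, fun i => (h1 i).1, fun i => (h1 i).2, h2, hsum, hsum',
      LPA.gradedIso_matrixSum hiso hiso'⟩
  tfae_have 3 → 2 := by
    rintro ⟨k', l, s, hl0, hl, hs, -, -, h⟩
    exact ⟨LPA.BlockGraph.{u} hl hm hs, inferInstance, LPA.finiteGraph_stepGraph,
      LPA.noExit_of_out LPA.stepGraph_out,
      LPA.gradedIso_trans h (LPA.gradedIso_blockGraph hl hm hs hl0)⟩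
  tfae_finish
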